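/- Let $0<\alpha<2$, let $\|\cdot\|_e$ and $\langle\cdot,\cdot\rangle$ be the Euclidean norm and scalar product of $\mathbb R^d$ and $S_d=\{s\in\mathbb R^d:\|s\|_e=1\}$. Put $w(\alpha,x)=\tan(\pi\alpha/2)$ if $\alpha\neq1$ and $w(1,x)=-\frac2\pi\ln|x|$. Let $X$ be an $\alpha$-stable random vector in $\mathbb R^d$ (for all $A,B>0$ there is $D\in\mathbb R^d$ such that $AX^{(1)}+BX^{(2)}$ has the law of $(A^\alpha+B^\alpha)^{1/\alpha}X+D$, where $X^{(1)},X^{(2)}$ are independent copies of $X$), with spectral representation $(\Gamma,\mu^0)$ on $S_d$; that is, $\Gamma$ is a finite Borel measure on $S_d$, $\mu^0\in\mathbb R^d$, and for all $u\in\mathbb R^d$ $$\mathbb E\,e^{i\langle u,X\rangle}=\exp\Big\{-\int_{S_d}|\langle u,s\rangle|^\alpha\big(1-i\,\mathrm{sign}(\langle u,s\rangle)\,w(\alpha,\langle u,s\rangle)\big)\,\Gamma(ds)+i\langle u,\mu^0\rangle\Big\}.\qquad(1)$$ Let $\|\cdot\|$ be a seminorm on $\mathbb R^d$, $C=\{s\in\mathbb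 R^d:\|s\|=1\}$ and $K=\{s\in S_d:\|s\|=0\}$. A spectral representation of $X$ on $C$ is a pair $(\gamma,m)$ of a Borel measure $\gamma$ on $C$ and a vector $m\in\mathbb R^d$ with the following properties. If $X$ is not symmetric: $\int_C|\langle u,s\rangle|^\alpha\,\gamma(ds)<\infty$ for all $u\in\mathbb R^d$ (when $\alpha\ne1$), respectively $\int_C|\langle u,s\rangle|\,\big|\ln|\langle u,s\rangle|\big|\,\gamma(ds)<\infty$ for all $u\in\mathbb R^d$ (when $\alpha=1$), and (1) holds with $(S_d,\Gamma,\mu^0)$ replaced by $(C,\gamma,m)$. If $X$ is symmetric: $m=0$, $\gamma$ is symmetric, and for all $u\in\mathbb R^d$, $\int_C|\langle u,s\rangle|^\alpha\,\gamma(ds)<\infty$ and $\mathbb E\,e^{i\langle u,X\rangle}=\exp\{-\int_C|\langle u,s\rangle|^\alpha\,\gamma(ds)\}$. The vector $X$ is called representable on $C$ if such a pair exists. Then: 1. If $\alpha\neq1$ or $X$ is symmetric, then $X$ is representable on $C$ if and only if $\Gamma(K)=0$. 2. If $\alpha=1$ and $X$ is not symmetric, then $X$ is representable on $C$ if and only if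 $\int_{S_d}\big|\ln\|s\|\big|\,\Gamma(ds)<\infty$ (where $|\ln 0|=+\infty$). 3. If $X$ is representable on $C$, then it has exactly one spectral representation $(\Gamma^{\|\cdot\|},\mu^0_{\|\cdot\|})$ on $C$, and it is given by $$\Gamma^{\|\cdot\|}(ds)=\|s\|_e^{-\alpha}\,\Gamma\circ T^{-1}(ds),\qquad T:S_d\setminus K\to C,\quad T(s)=s/\|s\|,$$ and by $\mu^0_{\|\cdot\|}=\mu^0$ if $\alpha\neq1$ or $X$ is symmetric, and $\mu^0_{\|\cdot\|}=\mu^0+\tilde\mu$ if $\alpha=1$ and $X$ is not symmetric, where $$\tilde\mu_j=-\frac2\pi\int_{S_d\setminus K}s_j\ln\|s\|\,\Gamma(ds),\qquad j=1,\dots,d.$$ -/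

import Mathlib

namespace StableCylinder

noncomputable section

open MeasureTheory

/-- `ℝ^d` with the canonical scalar product and the Euclidean norm. -/
abbrev E (d : ℕ) : Type := EuclideanSpace ℝ (Fin d)

/-- The law `ν` is `α`-stable: if `X₁, X₂` are independent with law `ν` and `A, B > 0`, then
`A X₁ + B X₂` has the law of `C X + D` for some vector `D`, where `X` has law `ν` and
`C = (A ^ α + B ^ α) ^ (1 / α)`. -/
def IsAlphaStable {d : ℕ} (α : ℝ) (ν : Measure (E d)) : Prop :=
  ∀ A B : ℝ, 0 < A → 0 < B → ∃ D : E d,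
    (ν.prod ν).map (fun x : E d × E d => A • x.1 + B • x.2) =
      ν.map (fun x : E d => ((A ^ α + B ^ α) ^ (1 / α)) • x + D)

/-- A measure on `ℝ^d` (a law or a spectral measure) is symmetric if it is invariant under
`x ↦ -x`. -/
def IsSymmetric {d : ℕ} (ν : Measure (E d)) : Prop :=
  ν.map (fun x : E d => -x) = ν

/-- `w(α, x) = tan (π α / 2)` if `α ≠ 1`, and `w(1, x) = -(2 / π) ln |x|`. -/
def w (α x : ℝ) : ℝ :=
  if α = 1 then -(2 / Real.pi) * Real.log |x| else Real.tan (Real.pi * α / 2)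

/-- The function `x ↦ |x| ^ α (1 - i sign(x) w(α, x))`. -/
def kern (α x : ℝ) : ℂ :=
  ((|x| ^ α : ℝ) : ℂ) * (1 - Complex.I * ((Real.sign x * w α x : ℝ) : ℂ))

/-- The stable characteristic function at `u` built from a measure `γ` and a shift `m`:
`exp (-∫ |⟨u,s⟩| ^ α (1 - i sign⟨u,s⟩ w(α,⟨u,s⟩)) γ(ds) + i ⟨u,m⟩)`. -/
def stableCF {d : ℕ} (α : ℝ) (γ : Measure (E d)) (m u : E d) : ℂ :=
  Complex.exp (-(∫ s, kern α (inner ℝ u s) ∂γ) + Complex.I * ((inner ℝ u m : ℝ) : ℂ))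

/-- The symmetric stable characteristic function at `u` built from a measure `γ`:
`exp (-∫ |⟨u,s⟩| ^ α γ(ds))`. -/
def symStableCF {d : ℕ} (α : ℝ) (γ : Measure (E d)) (u : E d) : ℂ :=
  Complex.exp (-((∫ s, |(inner ℝ u s : ℝ)| ^ α ∂γ : ℝ) : ℂ))

/-- The Euclidean unit sphere `S_d`. -/
def unitSphere (d : ℕ) : Set (E d) := {s | ‖s‖ = 1}

/-- The unit cylinder `{s | p s = 1}` of the seminorm `p`. -/
def cylinder {d : ℕ} (p : Seminorm ℝ (E d)) : Set (E d) := {s | p s = 1}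

/-- The set `K = {s ∈ S_d | p s = 0}`. -/
def kernelSet {d : ℕ} (p : Seminorm ℝ (E d)) : Set (E d) := {s | s ∈ unitSphere d ∧ p s = 0}

/-- `(Γ, μ₀)` is a spectral representation of the law `ν` on the Euclidean unit sphere. A measure
on `S_d` is encoded as a measure on `ℝ^d` that gives no mass to the complement of `S_d`. -/
structure IsSpectralRep {d : ℕ} (α : ℝ) (ν Γ : Measure (E d)) (μ₀ : E d) : Prop where
  finite : IsFiniteMeasure Γ
  concentrated : Γ (unitSphere d)ᶜ = 0
  charFun_eq : ∀ u : E d, charFun ν u = stableCF α Γ μ₀ u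

/-- `∫ |⟨u,s⟩| ^ α γ(ds) < ∞` for every `u`. -/
def IntegSimple {d : ℕ} (α : ℝ) (γ : Measure (E d)) : Prop :=
  ∀ u : E d, ∫⁻ s, ENNReal.ofReal (|(inner ℝ u s : ℝ)| ^ α) ∂γ < ⊤

/-- `∫ |⟨u,s⟩| |ln |⟨u,s⟩|| γ(ds) < ∞` for every `u` (with `0 · |ln 0| = 0`). -/
def IntegLog {d : ℕ} (γ : Measure (E d)) : Prop :=
  ∀ u : E d,
    ∫⁻ s, ENNReal.ofReal (|(inner ℝ u s : ℝ)| * |Real.log (|(inner ℝ u s : ℝ)|)|) ∂γ < ⊤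

/-- `(γ, m)` is a spectral representation of the law `ν` on the unit cylinder of `p`. A Borel
measure on the cylinder is encoded as a measure on `ℝ^d` that gives no mass to its complement.
If `ν` is symmetric, then `γ` has to be symmetric and there is no shift, that is, `m = 0`. -/
structure IsCylinderRep {d : ℕ} (p : Seminorm ℝ (E d)) (α : ℝ) (ν γ : Measure (E d)) (m : E d) :
    Prop where
  concentrated : γ (cylinder p)ᶜ = 0
  asymmetric : ¬ IsSymmetric ν →
    (α ≠ 1 → IntegSimple α γ) ∧ (α = 1 → IntegLog γ) ∧
      ∀ u : E d, charFun ν u = stableCF α γ m u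
  symmetric : IsSymmetric ν →
    m = 0 ∧ IsSymmetric γ ∧ IntegSimple α γ ∧ ∀ u : E d, charFun ν u = symStableCF α γ u

/-- The (`α`-stable) law `ν` is representable on the unit cylinder of `p`. -/
def IsRepresentable {d : ℕ} (p : Seminorm ℝ (E d)) (α : ℝ) (ν : Measure (E d)) : Prop :=
  ∃ (γ : Measure (E d)) (m : E d), IsCylinderRep p α ν γ m

/-- `|ln x|` for `x ≥ 0`, with the value `+∞` at `x = 0`. -/
def absLog (x : ℝ) : ENNReal :=
  if x = 0 then ⊤ else ENNReal.ofReal |Real.log x|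

/-- The measure `‖s‖_e ^ (-α) (Γ ∘ T⁻¹)(ds)`, where `T : S_d \ K → {s | p s = 1}` is the map
`T s = s / p s`. -/
def cylinderMeasure {d : ℕ} (p : Seminorm ℝ (E d)) (α : ℝ) (Γ : Measure (E d)) :
    Measure (E d) :=
  ((Γ.restrict (unitSphere d \ kernelSet p)).map (fun s : E d => (p s)⁻¹ • s)).withDensity
    (fun s : E d => ENNReal.ofReal (‖s‖ ^ (-α)))

/-- The vector with coordinates `-(2 / π) ∫_{S_d \ K} s_j ln (p s) Γ(ds)`. -/
def shiftCorrection {d : ℕ} (p : Seminorm ℝ (E d)) (Γ : Measure (E d)) : E d :=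
  WithLp.toLp 2 (fun j : Fin d =>
    -(2 / Real.pi) * ∫ s in unitSphere d \ kernelSet p, s j * Real.log (p s) ∂Γ)

open Classical in
/-- The shift vector on the cylinder: `μ₀`, corrected by `shiftCorrection` if `α = 1` and the law
`ν` is not symmetric. -/
def cylinderShift {d : ℕ} (p : Seminorm ℝ (E d)) (α : ℝ) (ν Γ : Measure (E d)) (μ₀ : E d) : E d :=
  if α = 1 ∧ ¬ IsSymmetric ν then μ₀ + shiftCorrection p Γ else μ₀

end

end StableCylinder

/-! Radial projection carries measures on the cylinder to measures on the Euclidean sphere that do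
not charge K, and back. Give γ the weight ‖s‖^α and project along s ↦ s/‖s‖ (`sphereMeasure`); since
p(s/‖s‖) = 1/‖s‖ when p(s) = 1, `cylinderMeasure` undoes this, with no finiteness assumption on γ.
The integrand `kern α` is α-homogeneous for α ≠ 1, so the exponent is unchanged. For α = 1 the
logarithm adds a term linear in u, which moves the shift by an integral of ln‖s‖ and explains the
logarithmic condition. In the symmetric case only |⟨u,s⟩|^α remains, and no such term occurs.

Everything then reduces to uniqueness of (Γ, μ⁰) on the sphere, `eq_of_stableCF_eq`. Equal
characteristic functions have equal exponents, by continuity and connectedness. Up to linear terms,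
the real and imaginary parts of the exponent determine ψ(u) = ∫ Φ(⟨u,s⟩) Γ(ds), where Φ is the Lévy
exponent of r^(-1-α) dr. Averaging ψ(u + ·) over a standard Gaussian and subtracting ψ(u) removes
the linear terms and leaves the Fourier transform of the finite measure (1 - e^(-r²/2)) r^(-1-α) dr
Γ(ds) in polar coordinates. This determines Γ, and then the shift. -/

namespace StableCylinder

noncomputable section

open MeasureTheory ProbabilityTheory

/-! ### Even and odd parts of the stable integrand -/

/-- The real function with `kern α x = |x| ^ α - i * kernOdd α x`. -/
def kernOdd (α x : ℝ) : ℝ := |x| ^ α * (Real.sign x * w α x)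

lemma kern_eq (α x : ℝ) :
    kern α x = ((|x| ^ α : ℝ) : ℂ) - Complex.I * (kernOdd α x : ℂ) := by
  simp only [kern, kernOdd]; push_cast; ring

lemma kernOdd_neg (α x : ℝ) : kernOdd α (-x) = -kernOdd α x := by
  unfold kernOdd w
  split_ifs <;> simp [Real.sign_neg]

lemma kernOdd_one (x : ℝ) : kernOdd 1 x = -(2 / Real.pi) * (x * Real.log x) := by
  have h : |x| * Real.sign x = x := by
    rcases lt_trichotomy x 0 with h | h | h
    · rw [Real.sign_of_neg h, abs_of_neg h]; ring
    · simp [h]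
    · rw [Real.sign_of_pos h, abs_of_pos h]; ring
  simp only [kernOdd, w, if_true, Real.rpow_one, Real.log_abs]
  rw [← mul_assoc, h]; ring

lemma continuous_abs_rpow {α : ℝ} (hα : 0 < α) : Continuous fun x : ℝ => |x| ^ α :=
  continuous_abs.rpow_const fun _ => Or.inr hα.le

lemma kernOdd_of_ne_one {α : ℝ} (h1 : α ≠ 1) (x : ℝ) :
    kernOdd α x = Real.tan (Real.pi * α / 2) * (Real.sign x * |x| ^ α) := by
  simp only [kernOdd, w, if_neg h1]; ring

lemma continuous_sign_mul_abs_rpow {α : ℝ} (hα : 0 < α) :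
    Continuous fun x : ℝ => Real.sign x * |x| ^ α := by
  have h : (fun x : ℝ => Real.sign x * |x| ^ α) =
      fun x : ℝ => (max x 0) ^ α - (max (-x) 0) ^ α := by
    funext x
    rcases lt_trichotomy x 0 with h | h | h
    · rw [Real.sign_of_neg h, abs_of_neg h, max_eq_right h.le, max_eq_left (by linarith),
        Real.zero_rpow hα.ne']; ring
    · simp [h, Real.zero_rpow hα.ne']
    · rw [Real.sign_of_pos h, abs_of_pos h, max_eq_left h.le, max_eq_right (by linarith),
        Real.zero_rpow hα.ne']; ring
  rw [h]
  exact ((continuous_id.max continuous_const).rpow_const fun _ => Or.inr hα.le).sub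
    ((continuous_neg.max continuous_const).rpow_const fun _ => Or.inr hα.le)

lemma continuous_kernOdd {α : ℝ} (hα : 0 < α) : Continuous (kernOdd α) := by
  by_cases h1 : α = 1
  · subst h1
    rw [show kernOdd 1 = fun x => -(2 / Real.pi) * (x * Real.log x) from funext kernOdd_one]
    exact continuous_const.mul Real.continuous_mul_log
  · rw [show kernOdd α = _ from funext (kernOdd_of_ne_one h1)]
    exact continuous_const.mul (continuous_sign_mul_abs_rpow hα)

lemma continuous_kern {α : ℝ} (hα : 0 < α) : Continuous (kern α) := by
  rw [show kern α = _ from funext (kern_eq α)]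
  exact (Complex.continuous_ofReal.comp (continuous_abs_rpow hα)).sub
    (continuous_const.mul (Complex.continuous_ofReal.comp (continuous_kernOdd hα)))

lemma kern_zero {α : ℝ} (hα : 0 < α) : kern α 0 = 0 := by
  simp [kern, Real.zero_rpow hα.ne']

/-! ### The Lévy exponent of the one-sided stable jump measure -/

/-- The compensated integrand `1 - e ^ (i r y) + i r y 1_{r ≤ 1}`. -/
def levyIntegrand (r y : ℝ) : ℂ :=
  1 - Complex.exp ((r * y : ℝ) * Complex.I) + (if r ≤ 1 then ((r * y : ℝ) : ℂ) * Complex.I else 0)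

/-- The Lévy exponent of the jump measure `r ^ (-1 - α) dr` on the positive half-line. -/
def levyExponent (α y : ℝ) : ℂ :=
  ∫ r in Set.Ioi (0 : ℝ), ((r ^ (-1 - α) : ℝ) : ℂ) * levyIntegrand r y

lemma norm_one_sub_exp_add_le (x : ℝ) :
    ‖1 - Complex.exp (x * Complex.I) + x * Complex.I‖ ≤ 3 * x ^ 2 := by
  have h1 : ‖(x : ℂ) * Complex.I‖ = |x| := by simp
  have hn : ‖1 - Complex.exp (x * Complex.I) + x * Complex.I‖ =
      ‖Complex.exp (x * Complex.I) - 1 - x * Complex.I‖ := by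
    rw [← norm_neg]; congr 1; ring
  rcases le_total |x| 1 with h | h
  · rw [hn]
    have := Complex.norm_exp_sub_one_sub_id_le (h1.trans_le h)
    rw [h1, sq_abs] at this
    nlinarith [sq_nonneg x]
  · have h2 : ‖Complex.exp (x * Complex.I)‖ = 1 := Complex.norm_exp_ofReal_mul_I x
    calc _ ≤ ‖(1 : ℂ) - Complex.exp (x * Complex.I)‖ + ‖(x : ℂ) * Complex.I‖ := norm_add_le _ _
      _ ≤ (‖(1 : ℂ)‖ + ‖Complex.exp (x * Complex.I)‖) + ‖(x : ℂ) * Complex.I‖ := by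
        gcongr; exact norm_sub_le _ _
      _ = 2 + |x| := by rw [h1, h2, norm_one]; norm_num
      _ ≤ 3 * x ^ 2 := by rw [← sq_abs]; nlinarith

/-- Taylor expansion gives r² for small r, and boundedness of the exponential gives 1 for large r.
The bound min(1, r²) is integrable against r^(-1-α) because 0 < α < 2. -/
lemma norm_levyIntegrand_le {r : ℝ} (hr : 0 < r) (y : ℝ) :
    ‖levyIntegrand r y‖ ≤ 3 * (1 + y ^ 2) * min 1 (r ^ 2) := by
  unfold levyIntegrand
  split_ifs with h
  · rw [min_eq_right (by nlinarith : r ^ 2 ≤ 1)]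
    refine (norm_one_sub_exp_add_le _).trans ?_
    nlinarith [sq_nonneg r]
  · rw [add_zero, min_eq_left (by nlinarith)]
    have h2 : ‖Complex.exp ((r * y : ℝ) * Complex.I)‖ = 1 := Complex.norm_exp_ofReal_mul_I _
    have := norm_sub_le (1 : ℂ) (Complex.exp ((r * y : ℝ) * Complex.I))
    rw [h2, norm_one] at this
    nlinarith [sq_nonneg y]

lemma measurable_levyIntegrand :
    Measurable fun q : ℝ × ℝ => levyIntegrand q.1 q.2 := by
  unfold levyIntegrand
  refine Measurable.add (by fun_prop) (Measurable.ite ?_ (by fun_prop) measurable_const)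
  exact measurableSet_le measurable_fst measurable_const

lemma integrableOn_rpow_mul_min {α : ℝ} (hα0 : 0 < α) (hα2 : α < 2) :
    IntegrableOn (fun r : ℝ => r ^ (-1 - α) * min 1 (r ^ 2)) (Set.Ioi 0) := by
  rw [← Set.Ioc_union_Ioi_eq_Ioi zero_le_one]
  refine IntegrableOn.union ?_ ?_
  · have h : IntegrableOn (fun r : ℝ => r ^ (1 - α)) (Set.Ioc 0 1) :=
      (intervalIntegrable_iff_integrableOn_Ioc_of_le zero_le_one).1
        (intervalIntegral.intervalIntegrable_rpow' (by linarith))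
    refine h.congr_fun (fun r hr => ?_) measurableSet_Ioc
    have h0 : 0 < r := hr.1
    have : r ^ 2 ≤ 1 := by nlinarith [hr.2]
    simp only
    rw [min_eq_right this, ← Real.rpow_natCast r 2, ← Real.rpow_add h0]
    congr 1; push_cast; ring
  · have h : IntegrableOn (fun r : ℝ => r ^ (-1 - α)) (Set.Ioi 1) :=
      integrableOn_Ioi_rpow_of_lt (by linarith) zero_lt_one
    refine h.congr_fun (fun r hr => ?_) measurableSet_Ioi
    have h0 : 1 < r := hr
    have : 1 ≤ r ^ 2 := by nlinarith
    simp only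
    rw [min_eq_left this, mul_one]

lemma integrableOn_levyIntegrand {α : ℝ} (hα0 : 0 < α) (hα2 : α < 2) (y : ℝ) :
    IntegrableOn (fun r : ℝ => ((r ^ (-1 - α) : ℝ) : ℂ) * levyIntegrand r y) (Set.Ioi 0) := by
  refine Integrable.mono' ((integrableOn_rpow_mul_min hα0 hα2).const_mul (3 * (1 + y ^ 2))) ?_ ?_
  · exact (Measurable.mul (by fun_prop)
      (measurable_levyIntegrand.comp (measurable_id.prodMk measurable_const))).aestronglyMeasurable
  · refine (ae_restrict_mem measurableSet_Ioi).mono fun r hr => ?_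
    rw [norm_mul, Complex.norm_real, Real.norm_of_nonneg (Real.rpow_nonneg (le_of_lt hr) _)]
    have := mul_le_mul_of_nonneg_left (norm_levyIntegrand_le hr y)
      (Real.rpow_nonneg (le_of_lt hr) (-1 - α))
    linarith

lemma levyExponent_zero (α : ℝ) : levyExponent α 0 = 0 := by
  simp [levyExponent, levyIntegrand]

lemma levyIntegrand_neg (r y : ℝ) :
    levyIntegrand r (-y) = (starRingEnd ℂ) (levyIntegrand r y) := by
  unfold levyIntegrand
  split_ifs <;> simp [← Complex.exp_conj]

lemma levyExponent_neg (α y : ℝ) :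
    levyExponent α (-y) = (starRingEnd ℂ) (levyExponent α y) := by
  unfold levyExponent
  rw [← integral_conj]
  simp only [levyIntegrand_neg, map_mul, Complex.conj_ofReal]

/-- Rescaling r moves the truncation point from 1 to 1/t, so only the linear compensator between
these two points changes. -/
lemma levyIntegrand_eq_scale {t : ℝ} (ht : 0 < t) {r : ℝ} :
    levyIntegrand r t = levyIntegrand (t * r) 1 + Complex.I * (t * r : ℝ) *
      ((Set.Ioc (1 / t) 1).indicator 1 r - (Set.Ioc 1 (1 / t)).indicator 1 r) := by
  have h1 : t * r ≤ 1 ↔ r ≤ 1 / t := by rw [le_div_iff₀ ht, mul_comm]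
  unfold levyIntegrand
  simp only [Set.indicator, Set.mem_Ioc, h1, Pi.one_apply]
  rcases le_or_gt r 1 with h | h <;> rcases le_or_gt r (1 / t) with h' | h' <;>
    simp only [h, h', not_le.2, not_lt.2, if_true, if_false, and_true, and_false] <;>
      push_cast <;> ring_nf

lemma integral_levyIntegrand_scale (α : ℝ) {t : ℝ} (ht : 0 < t) :
    ∫ r in Set.Ioi (0 : ℝ), ((r ^ (-1 - α) : ℝ) : ℂ) * levyIntegrand (t * r) 1 =
      ((t ^ α : ℝ) : ℂ) * levyExponent α 1 := by
  have h := integral_comp_mul_left_Ioi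
    (fun q : ℝ => (((t⁻¹ * q) ^ (-1 - α) : ℝ) : ℂ) * levyIntegrand q 1) 0 ht
  simp only [inv_mul_cancel_left₀ ht.ne', mul_zero] at h
  rw [h, levyExponent, ← integral_const_mul, ← integral_smul]
  refine setIntegral_congr_fun measurableSet_Ioi fun q hq => ?_
  have hq0 : 0 < q := hq
  have hr : t⁻¹ * (t⁻¹ * q) ^ (-1 - α) = t ^ α * q ^ (-1 - α) := by
    rw [Real.mul_rpow (inv_pos.2 ht).le hq0.le, Real.inv_rpow ht.le, ← Real.rpow_neg ht.le,
      ← mul_assoc, ← Real.rpow_neg_one t, ← Real.rpow_add ht]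
    congr 2; ring
  simp only [Complex.real_smul]
  rw [← mul_assoc, ← mul_assoc, ← Complex.ofReal_mul, ← Complex.ofReal_mul, hr]

lemma integrableOn_Ioc_rpow {α a b : ℝ} (ha : 0 < a) :
    IntegrableOn (fun r : ℝ => r ^ (-α)) (Set.Ioc a b) := by
  rcases le_total b a with h | h
  · simp [Set.Ioc_eq_empty (not_lt.2 h)]
  · refine (intervalIntegrable_iff_integrableOn_Ioc_of_le h).1
      (intervalIntegral.intervalIntegrable_rpow (Or.inr fun h0 => ?_))
    rw [Set.uIcc_of_le h] at h0
    exact absurd h0.1 (not_le.2 ha)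

/-- The jump density is homogeneous, so the exponent is too, except for the shifted truncation. The
remaining integral produces t ln t when α = 1, and a combination of t and t^α otherwise. -/
lemma levyExponent_of_pos {α : ℝ} (hα0 : 0 < α) (hα2 : α < 2) {t : ℝ} (ht : 0 < t) :
    levyExponent α t = ((t ^ α : ℝ) : ℂ) * levyExponent α 1 +
      Complex.I * ((t * ∫ r in (1 / t)..1, r ^ (-α) : ℝ) : ℂ) := by
  let A : ℝ → ℝ := (Set.Ioc (1 / t) 1).indicator fun r => r ^ (-α)
  let B : ℝ → ℝ := (Set.Ioc 1 (1 / t)).indicator fun r => r ^ (-α)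
  have hA : Integrable A := (integrable_indicator_iff measurableSet_Ioc).2
    (integrableOn_Ioc_rpow (one_div_pos.2 ht))
  have hB : Integrable B := (integrable_indicator_iff measurableSet_Ioc).2
    (integrableOn_Ioc_rpow zero_lt_one)
  have hJ : ∫ r in Set.Ioi (0 : ℝ), (A r - B r) = ∫ r in (1 / t)..1, r ^ (-α) := by
    have hsub : ∀ a b : ℝ, 0 < a → Set.Ioi (0 : ℝ) ∩ Set.Ioc a b = Set.Ioc a b := fun a b ha =>
      Set.inter_eq_right.2 fun x hx => ha.trans hx.1
    rw [integral_sub hA.integrableOn hB.integrableOn, setIntegral_indicator measurableSet_Ioc,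
      setIntegral_indicator measurableSet_Ioc, hsub _ _ (one_div_pos.2 ht),
      hsub _ _ zero_lt_one, intervalIntegral]
  have hsplit : ∀ r ∈ Set.Ioi (0 : ℝ), ((r ^ (-1 - α) : ℝ) : ℂ) * levyIntegrand (t * r) 1 =
      ((r ^ (-1 - α) : ℝ) : ℂ) * levyIntegrand r t -
        Complex.I * ((t * (A r - B r) : ℝ) : ℂ) := by
    intro r hr
    have hr0 : 0 < r := hr
    have hp : r ^ (-α) = r ^ (-1 - α) * r := by
      rw [← Real.rpow_add_one hr0.ne']; congr 1; ring
    rw [levyIntegrand_eq_scale ht]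
    simp only [A, B, Set.indicator, Pi.one_apply]
    split_ifs <;> (try rw [hp]) <;> push_cast <;> ring
  have h := integral_levyIntegrand_scale α ht
  rw [setIntegral_congr_fun measurableSet_Ioi hsplit, integral_sub
    (integrableOn_levyIntegrand hα0 hα2 t), integral_const_mul] at h
  · rw [← h, levyExponent]
    rw [integral_complex_ofReal, integral_const_mul, hJ]
    ring
  · exact (((hA.sub hB).const_mul t).ofReal.const_mul _).integrableOn

/-- Up to a linear term, the Lévy exponent is a combination of the two parts of `kern α`. -/
lemma exists_levyExponent_eq {α : ℝ} (hα0 : 0 < α) (hα2 : α < 2) :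
    ∃ c a b : ℂ, ∀ y : ℝ, levyExponent α y =
      c * ((|y| ^ α : ℝ) : ℂ) + a * (kernOdd α y : ℂ) + b * (y : ℂ) := by
  -- Negative y follow by conjugation: for real c, a, b it reverses the imaginary terms, which are
  -- odd in y.
  suffices h : ∃ c a b : ℝ, ∀ y : ℝ, 0 < y → levyExponent α y =
      c * ((|y| ^ α : ℝ) : ℂ) + (a * Complex.I) * (kernOdd α y : ℂ) +
        (b * Complex.I) * (y : ℂ) by
    obtain ⟨c, a, b, h⟩ := h
    refine ⟨c, a * Complex.I, b * Complex.I, fun y => ?_⟩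
    rcases lt_trichotomy y 0 with hy | hy | hy
    · have h1 := congrArg (starRingEnd ℂ) (h (-y) (by linarith))
      rw [← levyExponent_neg, neg_neg, kernOdd_neg, abs_neg] at h1
      rw [h1]
      simp
    · simp [hy, levyExponent_zero, kernOdd, Real.zero_rpow hα0.ne']
    · exact h y hy
  by_cases h1 : α = 1
  · subst h1
    -- The factor -(π/2) cancels the -(2/π) in `kernOdd 1`. The imaginary part of the exponent at 1
    -- multiplies y itself and is therefore absorbed by the linear term.
    refine ⟨(levyExponent 1 1).re, -(Real.pi / 2), (levyExponent 1 1).im, fun y hy => ?_⟩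
    rw [levyExponent_of_pos hα0 hα2 hy, kernOdd_one]
    have hJ : ∫ r in (1 / y)..1, r ^ (-1 : ℝ) = Real.log y := by
      simp_rw [Real.rpow_neg_one]
      rw [integral_inv_of_pos (by positivity) one_pos]; simp
    rw [hJ, Real.rpow_one, Real.rpow_one, abs_of_pos hy]
    conv_lhs => rw [← Complex.re_add_im (levyExponent 1 1)]
    have := Real.pi_ne_zero
    have : (Real.pi : ℂ) ≠ 0 := by exact_mod_cast this
    push_cast
    field_simp
    ring
  -- The angle πα/2 lies in (0, π) and differs from π/2, so neither sine nor cosine vanishes.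
  · have htan : Real.tan (Real.pi * α / 2) ≠ 0 := by
      rw [Real.tan_eq_sin_div_cos]
      have hpi := Real.pi_pos
      refine div_ne_zero (Real.sin_pos_of_pos_of_lt_pi (by positivity) (by nlinarith)).ne' ?_
      rcases lt_or_gt_of_ne h1 with h | h
      · exact (Real.cos_pos_of_mem_Ioo ⟨by nlinarith, by nlinarith⟩).ne'
      · exact (Real.cos_neg_of_pi_div_two_lt_of_lt (by nlinarith) (by nlinarith)).ne
    have h1' : 1 - α ≠ 0 := sub_ne_zero.2 (Ne.symm h1)
    -- The truncation integral is (y - y^α)/(1 - α): its y-part is the linear coefficient, and its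
    -- y^α-part corrects the imaginary coefficient.
    refine ⟨(levyExponent α 1).re,
      ((levyExponent α 1).im - 1 / (1 - α)) / Real.tan (Real.pi * α / 2), 1 / (1 - α),
      fun y hy => ?_⟩
    rw [levyExponent_of_pos hα0 hα2 hy, kernOdd_of_ne_one h1, Real.sign_of_pos hy]
    have hJ : y * ∫ r in (1 / y)..1, r ^ (-α) = (y - y ^ α) / (1 - α) := by
      rw [integral_rpow (Or.inr ⟨fun h => h1 (by linarith), fun h0 => ?_⟩)]
      · rw [show -α + 1 = 1 - α by ring, Real.one_rpow, one_div, Real.inv_rpow hy.le,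
          ← Real.rpow_neg hy.le, mul_div_assoc', mul_sub, mul_one]
        congr 2
        nth_rw 1 [← Real.rpow_one y]
        rw [← Real.rpow_add hy]; congr 1; ring
      · have : 0 < 1 / y := by positivity
        rcases Set.mem_uIcc.1 h0 with h | h <;> linarith [h.1, h.2]
    rw [hJ, abs_of_pos hy]
    conv_lhs => rw [← Complex.re_add_im (levyExponent α 1)]
    have h2 : ((1 - α : ℝ) : ℂ) ≠ 0 := by exact_mod_cast h1'
    have h3 : ((Real.tan (Real.pi * α / 2) : ℝ) : ℂ) ≠ 0 := by exact_mod_cast htan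
    generalize Real.tan (Real.pi * α / 2) = T at *
    push_cast at h2 ⊢
    field_simp
    ring

lemma continuous_levyExponent {α : ℝ} (hα0 : 0 < α) (hα2 : α < 2) :
    Continuous (levyExponent α) := by
  obtain ⟨c, a, b, h⟩ := exists_levyExponent_eq hα0 hα2
  rw [show levyExponent α = _ from funext h]
  exact ((continuous_const.mul (Complex.continuous_ofReal.comp (continuous_abs_rpow hα0))).add
    (continuous_const.mul (Complex.continuous_ofReal.comp (continuous_kernOdd hα0)))).add
    (continuous_const.mul Complex.continuous_ofReal)

/-- Quadratic growth is what makes Gaussian averages of the exponent finite. -/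
lemma exists_norm_levyExponent_le {α : ℝ} (hα0 : 0 < α) (hα2 : α < 2) :
    ∃ C : ℝ, ∀ y : ℝ, ‖levyExponent α y‖ ≤ C * (1 + y ^ 2) := by
  refine ⟨3 * ∫ r in Set.Ioi (0 : ℝ), r ^ (-1 - α) * min 1 (r ^ 2), fun y => ?_⟩
  have h := norm_integral_le_of_norm_le
    ((integrableOn_rpow_mul_min hα0 hα2).const_mul (3 * (1 + y ^ 2)))
    (f := fun r : ℝ => ((r ^ (-1 - α) : ℝ) : ℂ) * levyIntegrand r y) ?_
  · rw [integral_const_mul] at h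
    refine h.trans_eq (by ring)
  · refine (ae_restrict_mem measurableSet_Ioi).mono fun r hr => ?_
    rw [norm_mul, Complex.norm_real, Real.norm_of_nonneg (Real.rpow_nonneg (le_of_lt hr) _)]
    have := mul_le_mul_of_nonneg_left (norm_levyIntegrand_le hr y)
      (Real.rpow_nonneg (le_of_lt hr) (-1 - α))
    linarith

/-! ### Gaussian averaging of the Lévy exponent -/

lemma integral_exp_inner_stdGaussian {d : ℕ} {s : E d} (hs : ‖s‖ = 1) (r : ℝ) :
    ∫ v : E d, Complex.exp ((r * inner ℝ v s : ℝ) * Complex.I) ∂(stdGaussian (E d)) =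
      Complex.exp (-(r : ℂ) ^ 2 / 2) := by
  have h := charFun_stdGaussian (r • s)
  rw [charFun_apply] at h
  simp only [real_inner_smul_right, norm_smul, hs, mul_one] at h
  rw [h]
  congr 3
  rw [← Complex.ofReal_pow, ← Complex.ofReal_pow]; simp

lemma integrable_inner_stdGaussian {d : ℕ} (s : E d) :
    Integrable (fun v : E d => (inner ℝ v s : ℝ)) (stdGaussian (E d)) := by
  have h : Integrable (fun v : E d => v) (stdGaussian (E d)) := IsGaussian.integrable_id
  exact h.inner_const s

lemma integral_inner_stdGaussian {d : ℕ} (s : E d) :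
    ∫ v : E d, (inner ℝ v s : ℝ) ∂(stdGaussian (E d)) = 0 := by
  have h := integral_strongDual_stdGaussian (innerSL ℝ s)
  simpa [innerSL_apply_apply, real_inner_comm] using h

lemma integrable_norm_sq_stdGaussian (d : ℕ) :
    Integrable (fun v : E d => ‖v‖ ^ 2) (stdGaussian (E d)) := by
  have h : MemLp id 2 (stdGaussian (E d)) := IsGaussian.memLp_two_id
  exact h.integrable_norm_pow (by norm_num)

/-- ⟨v,s⟩ is centred with variance ‖s‖² = 1: the linear compensator averages to itself, and the
exponential acquires the factor e^(-r²/2). -/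
lemma integral_levyIntegrand_stdGaussian {d : ℕ} {s : E d} (hs : ‖s‖ = 1) (r x : ℝ) :
    ∫ v : E d, levyIntegrand r (x + inner ℝ v s) ∂(stdGaussian (E d)) =
      levyIntegrand r x +
        Complex.exp ((r * x : ℝ) * Complex.I) * ((1 - Real.exp (-r ^ 2 / 2) : ℝ) : ℂ) := by
  have hexp : ∀ v : E d, Complex.exp ((r * (x + inner ℝ v s) : ℝ) * Complex.I) =
      Complex.exp ((r * x : ℝ) * Complex.I) *
        Complex.exp ((r * inner ℝ v s : ℝ) * Complex.I) := by
    intro v; rw [← Complex.exp_add]; congr 1; push_cast; ring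
  have hi1 : Integrable (fun v : E d => Complex.exp ((r * x : ℝ) * Complex.I) *
        Complex.exp ((r * inner ℝ v s : ℝ) * Complex.I)) (stdGaussian (E d)) := by
    refine Integrable.of_bound (C := 1) (by fun_prop) (ae_of_all _ fun v => ?_)
    rw [norm_mul, Complex.norm_exp_ofReal_mul_I, Complex.norm_exp_ofReal_mul_I, one_mul]
  have hi2 : Integrable (fun v : E d => if r ≤ 1 then
      ((r * (x + inner ℝ v s) : ℝ) : ℂ) * Complex.I else 0) (stdGaussian (E d)) := by
    split_ifs
    · exact ((((integrable_const x).add (integrable_inner_stdGaussian s)).const_mul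
        r).ofReal).mul_const _
    · exact integrable_zero _ _ _
  have hi3 : ∫ v : E d, (if r ≤ 1 then
      ((r * (x + inner ℝ v s) : ℝ) : ℂ) * Complex.I else 0) ∂(stdGaussian (E d)) =
      if r ≤ 1 then ((r * x : ℝ) : ℂ) * Complex.I else 0 := by
    split_ifs
    · rw [integral_mul_const, integral_complex_ofReal, integral_const_mul,
        integral_add (integrable_const x) (integrable_inner_stdGaussian s),
        integral_inner_stdGaussian]
      simp
    · simp
  unfold levyIntegrand
  simp only [hexp]
  have hi4 := (integrable_const (μ := stdGaussian (E d)) (1 : ℂ)).sub hi1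
  simp only [Pi.sub_def] at hi4
  rw [integral_add hi4 hi2, integral_sub (integrable_const 1) hi1,
    integral_const_mul, integral_exp_inner_stdGaussian hs, hi3]
  have : Complex.exp (-(r : ℂ) ^ 2 / 2) = ((Real.exp (-r ^ 2 / 2) : ℝ) : ℂ) := by push_cast; rfl
  rw [this]
  simp
  ring

lemma one_sub_exp_nonneg (r : ℝ) : 0 ≤ 1 - Real.exp (-r ^ 2 / 2) := by
  rw [sub_nonneg, Real.exp_le_one_iff]; nlinarith [sq_nonneg r]

lemma one_sub_exp_le (r : ℝ) : 1 - Real.exp (-r ^ 2 / 2) ≤ min 1 (r ^ 2) := by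
  refine le_min (by linarith [Real.exp_pos (-r ^ 2 / 2)]) ?_
  nlinarith [Real.add_one_le_exp (-r ^ 2 / 2), sq_nonneg r]

lemma integrableOn_smoothedDensity {α : ℝ} (hα0 : 0 < α) (hα2 : α < 2) :
    IntegrableOn (fun r : ℝ => r ^ (-1 - α) * (1 - Real.exp (-r ^ 2 / 2))) (Set.Ioi 0) := by
  refine Integrable.mono' (integrableOn_rpow_mul_min hα0 hα2)
    (Measurable.aestronglyMeasurable (by fun_prop)) ?_
  refine (ae_restrict_mem measurableSet_Ioi).mono fun r hr => ?_
  have h0 := Real.rpow_nonneg (le_of_lt (Set.mem_Ioi.1 hr)) (-1 - α)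
  rw [Real.norm_of_nonneg (mul_nonneg h0 (one_sub_exp_nonneg r))]
  exact mul_le_mul_of_nonneg_left (one_sub_exp_le r) h0

/-- The compensator cancels in the difference, and the new weight 1 - e^(-r²/2) is O(r²) at zero.
The jump density thus becomes integrable and the difference is an honest Fourier integral. -/
lemma integral_levyExponent_stdGaussian {d : ℕ} {α : ℝ} (hα0 : 0 < α) (hα2 : α < 2)
    {s : E d} (hs : ‖s‖ = 1) (x : ℝ) :
    ∫ v : E d, levyExponent α (x + inner ℝ v s) ∂(stdGaussian (E d)) =
      levyExponent α x + ∫ r in Set.Ioi (0 : ℝ),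
        ((r ^ (-1 - α) * (1 - Real.exp (-r ^ 2 / 2)) : ℝ) : ℂ) *
          Complex.exp ((r * x : ℝ) * Complex.I) := by
  have hsq : Integrable (fun v : E d => 3 * (1 + (x + inner ℝ v s) ^ 2))
      (stdGaussian (E d)) := by
    refine Integrable.const_mul ((integrable_const 1).add ?_) 3
    refine Integrable.mono' (((integrable_const (x ^ 2)).add
      (integrable_norm_sq_stdGaussian d)).const_mul 2)
      (Measurable.aestronglyMeasurable (by fun_prop)) (ae_of_all _ fun v => ?_)
    have h := abs_real_inner_le_norm v s
    rw [hs, mul_one] at h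
    have h2 : (inner ℝ v s : ℝ) ^ 2 ≤ ‖v‖ ^ 2 := sq_le_sq.2 (by rwa [abs_norm])
    rw [Real.norm_of_nonneg (sq_nonneg _)]
    simp only [Pi.add_apply]
    nlinarith [sq_nonneg (x - inner ℝ v s)]
  have hint : Integrable (Function.uncurry fun (v : E d) (r : ℝ) =>
      ((r ^ (-1 - α) : ℝ) : ℂ) * levyIntegrand r (x + inner ℝ v s))
      ((stdGaussian (E d)).prod (volume.restrict (Set.Ioi 0))) := by
    refine Integrable.mono' (hsq.mul_prod (integrableOn_rpow_mul_min hα0 hα2)) ?_ ?_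
    · refine (Measurable.mul (by fun_prop) (measurable_levyIntegrand.comp
        (measurable_snd.prodMk (by fun_prop)))).aestronglyMeasurable
    · have hpos : ∀ᵐ q : E d × ℝ ∂((stdGaussian (E d)).prod (volume.restrict (Set.Ioi 0))),
          q.2 ∈ Set.Ioi (0 : ℝ) :=
        Measure.quasiMeasurePreserving_snd.ae (ae_restrict_mem measurableSet_Ioi)
      refine hpos.mono fun q hq => ?_
      simp only [Function.uncurry]
      rw [norm_mul, Complex.norm_real, Real.norm_of_nonneg (Real.rpow_nonneg (le_of_lt hq) _)]
      have := mul_le_mul_of_nonneg_left (norm_levyIntegrand_le hq (x + inner ℝ q.1 s))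
        (Real.rpow_nonneg (le_of_lt hq) (-1 - α))
      linarith
  simp only [levyExponent]
  rw [integral_integral_swap hint, ← integral_add (integrableOn_levyIntegrand hα0 hα2 x)]
  · refine integral_congr_ae (ae_of_all _ fun r => ?_)
    simp only
    rw [integral_const_mul, integral_levyIntegrand_stdGaussian hs]
    push_cast; ring
  · refine (integrableOn_smoothedDensity hα0 hα2).ofReal.mul_bdd (c := 1) (by fun_prop)
      (ae_of_all _ fun r => (Complex.norm_exp_ofReal_mul_I _).le)

/-! ### The smoothed Lévy measure and its Fourier transform -/

/-- The jump measure `r ^ (-1 - α) dr`, made finite by the weight `1 - exp (-r ^ 2 / 2)`. -/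
def radialMeasure (α : ℝ) : Measure ℝ :=
  (volume.restrict (Set.Ioi 0)).withDensity
    fun r => ENNReal.ofReal (r ^ (-1 - α) * (1 - Real.exp (-r ^ 2 / 2)))

lemma isFiniteMeasure_radialMeasure {α : ℝ} (hα0 : 0 < α) (hα2 : α < 2) :
    IsFiniteMeasure (radialMeasure α) :=
  isFiniteMeasure_withDensity_ofReal (integrableOn_smoothedDensity hα0 hα2).2

lemma ae_pos_radialMeasure (α : ℝ) : ∀ᵐ r ∂(radialMeasure α), 0 < r :=
  (withDensity_absolutelyContinuous _ _).ae_le (ae_restrict_mem measurableSet_Ioi)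

lemma radialMeasure_univ_ne_zero (α : ℝ) : radialMeasure α Set.univ ≠ 0 := by
  intro h
  rw [Measure.measure_univ_eq_zero, radialMeasure, withDensity_eq_zero_iff (by fun_prop)] at h
  have h0 : ∀ᵐ r ∂(volume.restrict (Set.Ioi (0 : ℝ))), False := by
    filter_upwards [h, ae_restrict_mem measurableSet_Ioi] with r hr hr0
    have hr0 : 0 < r := hr0
    rw [Pi.zero_apply, ENNReal.ofReal_eq_zero] at hr
    have : Real.exp (-r ^ 2 / 2) < 1 := by rw [Real.exp_lt_one_iff]; nlinarith
    nlinarith [mul_pos (Real.rpow_pos_of_pos hr0 (-1 - α)) (sub_pos.2 this)]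
  rw [ae_iff] at h0
  simp at h0

lemma integral_radialMeasure (α : ℝ) (f : ℝ → ℂ) :
    ∫ r, f r ∂(radialMeasure α) = ∫ r in Set.Ioi (0 : ℝ),
      ((r ^ (-1 - α) * (1 - Real.exp (-r ^ 2 / 2)) : ℝ) : ℂ) * f r := by
  rw [radialMeasure, integral_withDensity_eq_integral_toReal_smul (by fun_prop)
    (ae_of_all _ fun _ => ENNReal.ofReal_lt_top)]
  refine setIntegral_congr_fun measurableSet_Ioi fun r hr => ?_
  rw [ENNReal.toReal_ofReal (mul_nonneg (Real.rpow_nonneg (le_of_lt hr) _)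
    (one_sub_exp_nonneg r)), Complex.real_smul]

/-- The smoothed Lévy measure with spherical part `Γ`. -/
def levyMeasure {d : ℕ} (α : ℝ) (Γ : Measure (E d)) : Measure (E d) :=
  (Γ.prod (radialMeasure α)).map fun q => q.2 • q.1

lemma ae_norm_eq_one {d : ℕ} {Γ : Measure (E d)} (h : Γ (unitSphere d)ᶜ = 0) :
    ∀ᵐ s ∂Γ, ‖s‖ = 1 := h

/-- In polar coordinates the smoothed measure is a product, so forgetting the radius returns Γ times
the total radial mass. -/
lemma map_normalize_levyMeasure {d : ℕ} {α : ℝ} (hα0 : 0 < α) (hα2 : α < 2)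
    {Γ : Measure (E d)} [IsFiniteMeasure Γ] (hΓ : Γ (unitSphere d)ᶜ = 0) :
    (levyMeasure α Γ).map (fun x => ‖x‖⁻¹ • x) = radialMeasure α Set.univ • Γ := by
  have := isFiniteMeasure_radialMeasure hα0 hα2
  rw [levyMeasure, Measure.map_map (by fun_prop) (by fun_prop), ← Measure.map_fst_prod]
  refine Measure.map_congr ?_
  filter_upwards [Measure.quasiMeasurePreserving_snd.ae (ae_pos_radialMeasure α),
    Measure.quasiMeasurePreserving_fst.ae (ae_norm_eq_one hΓ)] with q h2 h1
  simp only [Function.comp, norm_smul, h1, mul_one, Real.norm_of_nonneg h2.le, smul_smul]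
  rw [inv_mul_cancel₀ h2.ne', one_smul]

lemma charFun_levyMeasure {d : ℕ} {α : ℝ} (hα0 : 0 < α) (hα2 : α < 2)
    {Γ : Measure (E d)} [IsFiniteMeasure Γ] (u : E d) :
    charFun (levyMeasure α Γ) u = ∫ s, (∫ r in Set.Ioi (0 : ℝ),
        ((r ^ (-1 - α) * (1 - Real.exp (-r ^ 2 / 2)) : ℝ) : ℂ) *
          Complex.exp ((r * inner ℝ u s : ℝ) * Complex.I)) ∂Γ := by
  have := isFiniteMeasure_radialMeasure hα0 hα2
  rw [charFun_apply, levyMeasure, integral_map (by fun_prop) (by fun_prop), integral_prod]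
  · simp only [integral_radialMeasure, real_inner_smul_right, real_inner_comm u]
  · refine Integrable.of_bound (C := 1) (by fun_prop) (ae_of_all _ fun v => ?_)
    rw [Complex.norm_exp_ofReal_mul_I]

lemma integrable_comp_inner {d : ℕ} {F : Type*} [NormedAddCommGroup F]
    {Γ : Measure (E d)} [IsFiniteMeasure Γ] (hΓ : Γ (unitSphere d)ᶜ = 0) {f : ℝ → F}
    (hf : Continuous f) (u : E d) : Integrable (fun s => f (inner ℝ u s)) Γ := by
  obtain ⟨C, hC⟩ := (isCompact_Icc (a := -‖u‖) (b := ‖u‖)).exists_bound_of_continuousOn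
    hf.continuousOn
  refine Integrable.of_bound (C := C)
    (hf.comp (by fun_prop : Continuous fun s : E d => (inner ℝ u s : ℝ))).aestronglyMeasurable
    ((ae_norm_eq_one hΓ).mono fun s hs => hC _ ?_)
  have h := abs_real_inner_le_norm u s
  rw [hs, mul_one] at h
  exact abs_le.1 h

/-- Fubini applied to the identity for one direction. All directions share the same radial weight
because ‖s‖ = 1. -/
lemma charFun_levyMeasure_eq_sub {d : ℕ} {α : ℝ} (hα0 : 0 < α) (hα2 : α < 2)
    {Γ : Measure (E d)} [IsFiniteMeasure Γ] (hΓ : Γ (unitSphere d)ᶜ = 0) (u : E d) :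
    Integrable (fun v : E d => ∫ s, levyExponent α (inner ℝ (u + v) s) ∂Γ)
        (stdGaussian (E d)) ∧
      charFun (levyMeasure α Γ) u =
        ∫ v : E d, (∫ s, levyExponent α (inner ℝ (u + v) s) ∂Γ) ∂(stdGaussian (E d)) -
          ∫ s, levyExponent α (inner ℝ u s) ∂Γ := by
  obtain ⟨C, hC⟩ := exists_norm_levyExponent_le hα0 hα2
  have hmeas := (continuous_levyExponent hα0 hα2).measurable
  have hint : Integrable (Function.uncurry fun (v s : E d) =>
      levyExponent α (inner ℝ (u + v) s)) ((stdGaussian (E d)).prod Γ) := by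
    have hb : Integrable (fun q : E d × E d => (|C| * (1 + 2 * (‖u‖ ^ 2 + ‖q.1‖ ^ 2))) * (1 : ℝ))
        ((stdGaussian (E d)).prod Γ) :=
      Integrable.mul_prod (f := fun v : E d => |C| * (1 + 2 * (‖u‖ ^ 2 + ‖v‖ ^ 2)))
        (g := fun _ => (1 : ℝ)) (((integrable_const 1).add (((integrable_const _).add
        (integrable_norm_sq_stdGaussian d)).const_mul 2)).const_mul _) (integrable_const 1)
    refine hb.mono' (Measurable.aestronglyMeasurable (hmeas.comp (by fun_prop))) ?_
    filter_upwards [Measure.quasiMeasurePreserving_snd.ae (ae_norm_eq_one hΓ)] with q h1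
    refine (hC _).trans ((mul_le_mul_of_nonneg_right (le_abs_self C) (by positivity)).trans ?_)
    rw [mul_one]
    refine mul_le_mul_of_nonneg_left ?_ (abs_nonneg C)
    have h := abs_real_inner_le_norm (u + q.1) q.2
    rw [h1, mul_one] at h
    have h2 : (inner ℝ (u + q.1) q.2 : ℝ) ^ 2 ≤ ‖u + q.1‖ ^ 2 :=
      sq_le_sq.2 (by rwa [abs_norm])
    have h3 := norm_add_le u q.1
    have h4 : ‖u + q.1‖ ^ 2 ≤ (‖u‖ + ‖q.1‖) ^ 2 := by gcongr
    nlinarith [sq_nonneg (‖u‖ - ‖q.1‖)]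
  refine ⟨hint.integral_prod_left, ?_⟩
  have hΦ := integrable_comp_inner hΓ (continuous_levyExponent hα0 hα2) u
  rw [integral_integral_swap hint, charFun_levyMeasure hα0 hα2, ← integral_sub _ hΦ]
  · refine integral_congr_ae ((ae_norm_eq_one hΓ).mono fun s hs => ?_)
    simp only [inner_add_left]
    rw [integral_levyExponent_stdGaussian hα0 hα2 hs]
    ring
  · exact hint.integral_prod_right

/-! ### Uniqueness of the spectral representation on the sphere -/

/-- A measure on the sphere is determined by its Lévy exponent, up to an additive function with
Gaussian mean zero. -/
lemma ext_of_levyExponent {d : ℕ} {α : ℝ} (hα0 : 0 < α) (hα2 : α < 2)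
    {Γ Γ' : Measure (E d)} [IsFiniteMeasure Γ] [IsFiniteMeasure Γ']
    (hΓ : Γ (unitSphere d)ᶜ = 0) (hΓ' : Γ' (unitSphere d)ᶜ = 0) (ℓ : E d → ℂ)
    (hadd : ∀ u v, ℓ (u + v) = ℓ u + ℓ v) (hint : ∫ v, ℓ v ∂(stdGaussian (E d)) = 0)
    (h : ∀ u : E d, ∫ s, levyExponent α (inner ℝ u s) ∂Γ =
      ∫ s, levyExponent α (inner ℝ u s) ∂Γ' + ℓ u) : Γ = Γ' := by
  have := isFiniteMeasure_radialMeasure hα0 hα2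
  have hf : ∀ (Γ : Measure (E d)) [IsFiniteMeasure Γ], IsFiniteMeasure (levyMeasure α Γ) := by
    intro Γ _; unfold levyMeasure; infer_instance
  have := hf Γ
  have := hf Γ'
  have heq : levyMeasure α Γ = levyMeasure α Γ' := by
    refine Measure.ext_of_charFun (funext fun u => ?_)
    obtain ⟨h1, h2⟩ := charFun_levyMeasure_eq_sub hα0 hα2 hΓ u
    obtain ⟨h3, h4⟩ := charFun_levyMeasure_eq_sub hα0 hα2 hΓ' u
    -- Integrability of ℓ is inherited from the difference of the two averaged exponents; additivity
    -- then removes the translation by u.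
    have hℓ : Integrable (fun v => ℓ (u + v)) (stdGaussian (E d)) := by
      refine (h1.sub h3).congr (ae_of_all _ fun v => ?_)
      simp only [Pi.sub_apply, h (u + v)]; ring
    have hℓ' : Integrable ℓ (stdGaussian (E d)) := by
      refine (hℓ.sub (integrable_const (ℓ u))).congr (ae_of_all _ fun v => ?_)
      simp only [Pi.sub_apply, hadd]; ring
    rw [h2, h4]
    simp only [h]
    rw [integral_add h3 hℓ]
    simp only [hadd]
    rw [integral_add (integrable_const _) hℓ', hint]
    simp
  have hmap := congrArg (Measure.map fun x : E d => ‖x‖⁻¹ • x) heq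
  rw [map_normalize_levyMeasure hα0 hα2 hΓ, map_normalize_levyMeasure hα0 hα2 hΓ'] at hmap
  refine Measure.ext fun A _ => ?_
  have hA := congrArg (fun μ : Measure (E d) => μ A) hmap
  simp only [Measure.smul_apply, smul_eq_mul] at hA
  exact (ENNReal.mul_right_inj (radialMeasure_univ_ne_zero α) (measure_ne_top _ _)).1 hA

/-- D/(2πi) is continuous and integer-valued, hence constant on a connected space. This makes the
exponent of a characteristic function unique. -/
lemma eq_zero_of_exp_eq_one {X : Type*} [TopologicalSpace X] [PreconnectedSpace X]
    {D : X → ℂ} (hD : Continuous D) (h : ∀ x, Complex.exp (D x) = 1) {x₀ : X} (h0 : D x₀ = 0)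
    (x : X) : D x = 0 := by
  choose n hn using fun x => Complex.exp_eq_one_iff.1 (h x)
  have hpi : (2 * Real.pi : ℝ) ≠ 0 := by positivity
  have him : ∀ x, (D x).im / (2 * Real.pi) = n x := fun x => by
    rw [hn x]; simp
  have hcont : Continuous n := by
    rw [Int.isClosedEmbedding_coe_real.isInducing.continuous_iff]
    exact ((Complex.continuous_im.comp hD).div_const (2 * Real.pi)).congr him
  have hc := PreconnectedSpace.constant inferInstance hcont (x := x) (y := x₀)
  have hn0 : n x₀ = 0 := by
    have := him x₀
    rw [h0] at this
    simpa using this.symm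
  rw [hn x, hc, hn0]; simp

lemma continuous_integral_kern {d : ℕ} {α : ℝ} (hα : 0 < α) {Γ : Measure (E d)}
    [IsFiniteMeasure Γ] (hΓ : Γ (unitSphere d)ᶜ = 0) :
    Continuous fun u : E d => ∫ s, kern α (inner ℝ u s) ∂Γ := by
  refine continuous_iff_continuousAt.2 fun u₀ => ?_
  obtain ⟨C, hC⟩ := (isCompact_Icc (a := -(‖u₀‖ + 1)) (b := ‖u₀‖ + 1)).exists_bound_of_continuousOn
    (continuous_kern hα).continuousOn
  refine continuousAt_of_dominated (bound := fun _ => C) (Filter.Eventually.of_forall fun u =>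
    (integrable_comp_inner hΓ (continuous_kern hα) u).aestronglyMeasurable) ?_
    (integrable_const C) (ae_of_all _ fun s => ?_)
  · filter_upwards [Metric.ball_mem_nhds u₀ one_pos] with u hu
    refine (ae_norm_eq_one hΓ).mono fun s hs => hC _ (abs_le.1 ?_)
    have h := abs_real_inner_le_norm u s
    rw [hs, mul_one] at h
    have h1 : ‖u - u₀‖ < 1 := mem_ball_iff_norm.1 hu
    have h2 : ‖u‖ ≤ ‖u₀‖ + ‖u - u₀‖ := by
      simpa using norm_add_le u₀ (u - u₀)
    linarith
  · exact ((continuous_kern hα).comp (by fun_prop)).continuousAt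

lemma integral_kern_eq_add {d : ℕ} {α : ℝ} (hα : 0 < α)
    {Γ Γ' : Measure (E d)} [IsFiniteMeasure Γ] [IsFiniteMeasure Γ']
    (hΓ : Γ (unitSphere d)ᶜ = 0) (hΓ' : Γ' (unitSphere d)ᶜ = 0) {m m' : E d}
    (h : ∀ u, stableCF α Γ m u = stableCF α Γ' m' u) (u : E d) :
    ∫ s, kern α (inner ℝ u s) ∂Γ =
      ∫ s, kern α (inner ℝ u s) ∂Γ' + Complex.I * ((inner ℝ u (m - m') : ℝ) : ℂ) := by
  have hcont : ∀ m : E d, Continuous fun u : E d => Complex.I * ((inner ℝ u m : ℝ) : ℂ) :=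
    fun m => by fun_prop
  have h0 := eq_zero_of_exp_eq_one (x₀ := (0 : E d)) (D := fun u : E d =>
      (-(∫ s, kern α (inner ℝ u s) ∂Γ) + Complex.I * ((inner ℝ u m : ℝ) : ℂ)) -
      (-(∫ s, kern α (inner ℝ u s) ∂Γ') + Complex.I * ((inner ℝ u m' : ℝ) : ℂ)))
    (((continuous_integral_kern hα hΓ).neg.add (hcont m)).sub
      ((continuous_integral_kern hα hΓ').neg.add (hcont m')))
    (fun u => by
      have := h u
      simp only [stableCF] at this
      rw [Complex.exp_sub, this, div_self (Complex.exp_ne_zero _)])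
    (by simp [kern_zero hα]) u
  rw [inner_sub_right, Complex.ofReal_sub]
  linear_combination -h0

/-- A spectral representation on the Euclidean unit sphere is determined by its characteristic
function. -/
lemma eq_of_stableCF_eq {d : ℕ} {α : ℝ} (hα0 : 0 < α) (hα2 : α < 2)
    {Γ Γ' : Measure (E d)} [IsFiniteMeasure Γ] [IsFiniteMeasure Γ']
    (hΓ : Γ (unitSphere d)ᶜ = 0) (hΓ' : Γ' (unitSphere d)ᶜ = 0) {m m' : E d}
    (h : ∀ u, stableCF α Γ m u = stableCF α Γ' m' u) : Γ = Γ' ∧ m = m' := by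
  have hk := integral_kern_eq_add hα0 hΓ hΓ' h
  obtain ⟨c, a, b, habc⟩ := exists_levyExponent_eq hα0 hα2
  have hsplit : ∀ (Γ : Measure (E d)) [IsFiniteMeasure Γ], Γ (unitSphere d)ᶜ = 0 → ∀ u : E d,
      ∫ s, kern α (inner ℝ u s) ∂Γ = ((∫ s, |(inner ℝ u s : ℝ)| ^ α ∂Γ : ℝ) : ℂ) -
        Complex.I * ((∫ s, kernOdd α (inner ℝ u s) ∂Γ : ℝ) : ℂ) ∧
      ∫ s, levyExponent α (inner ℝ u s) ∂Γ =
        c * ((∫ s, |(inner ℝ u s : ℝ)| ^ α ∂Γ : ℝ) : ℂ) +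
        a * ((∫ s, kernOdd α (inner ℝ u s) ∂Γ : ℝ) : ℂ) +
        b * ((inner ℝ u (∫ s, s ∂Γ) : ℝ) : ℂ) := by
    intro Γ _ hΓ u
    have h1 := integrable_comp_inner hΓ (continuous_abs_rpow hα0) u
    have h2 := integrable_comp_inner hΓ (continuous_kernOdd hα0) u
    have h3 := integrable_comp_inner hΓ continuous_id u
    have h4 : Integrable (fun s : E d => s) Γ :=
      Integrable.of_bound (C := 1) (by fun_prop) ((ae_norm_eq_one hΓ).mono fun s hs => hs.le)
    have h5 : ∫ s, (inner ℝ u s : ℝ) ∂Γ = inner ℝ u (∫ s, s ∂Γ) := integral_inner h4 u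
    constructor
    · simp only [kern_eq]
      rw [integral_sub h1.ofReal (h2.ofReal.const_mul _), integral_const_mul,
        integral_complex_ofReal, integral_complex_ofReal]
    · simp only [habc]
      rw [integral_add ((h1.ofReal.const_mul _).add (h2.ofReal.const_mul _))
        (h3.ofReal.const_mul _), integral_add (h1.ofReal.const_mul _) (h2.ofReal.const_mul _),
        integral_const_mul, integral_const_mul, integral_const_mul,
        integral_complex_ofReal, integral_complex_ofReal, integral_complex_ofReal, ← h5]
  -- The shift enters only the imaginary part, so the even part is determined exactly and the odd
  -- part up to a linear function.
  have hre : ∀ u : E d, ∫ s, |(inner ℝ u s : ℝ)| ^ α ∂Γ = ∫ s, |(inner ℝ u s : ℝ)| ^ α ∂Γ' := by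
    intro u
    have := congrArg Complex.re (hk u)
    rw [(hsplit Γ hΓ u).1, (hsplit Γ' hΓ' u).1] at this
    simpa using this
  have him : ∀ u : E d, ∫ s, kernOdd α (inner ℝ u s) ∂Γ =
      ∫ s, kernOdd α (inner ℝ u s) ∂Γ' - inner ℝ u (m - m') := by
    intro u
    have := congrArg Complex.im (hk u)
    rw [(hsplit Γ hΓ u).1, (hsplit Γ' hΓ' u).1] at this
    simp only [Complex.sub_im, Complex.add_im, Complex.ofReal_im, Complex.mul_im, Complex.I_re,
      Complex.I_im, Complex.ofReal_re] at this
    linarith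
  have hΓΓ' : Γ = Γ' := by
    -- The error combines that linear function with the first moments coming from the linear term of
    -- the Lévy exponent. It is linear in u, so its Gaussian mean is zero.
    refine ext_of_levyExponent hα0 hα2 hΓ hΓ' (fun u =>
      -a * ((inner ℝ u (m - m') : ℝ) : ℂ) +
        b * ((inner ℝ u (∫ s, s ∂Γ - ∫ s, s ∂Γ') : ℝ) : ℂ)) (fun u v => ?_) ?_ (fun u => ?_)
    · simp only [inner_add_left, Complex.ofReal_add]; ring
    · rw [integral_add ((integrable_inner_stdGaussian _).ofReal.const_mul _)
        ((integrable_inner_stdGaussian _).ofReal.const_mul _), integral_const_mul,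
        integral_const_mul, integral_complex_ofReal, integral_complex_ofReal,
        integral_inner_stdGaussian, integral_inner_stdGaussian]
      simp
    · rw [(hsplit Γ hΓ u).2, (hsplit Γ' hΓ' u).2, hre u, him u, inner_sub_right u (∫ s, s ∂Γ)]
      push_cast
      ring
  refine ⟨hΓΓ', ?_⟩
  subst hΓΓ'
  have h0 := him (m - m')
  have : (inner ℝ (m - m') (m - m') : ℝ) = 0 := by linarith
  exact sub_eq_zero.1 (inner_self_eq_zero.1 this)

/-! ### Symmetric laws -/

lemma measurableEmbedding_neg (d : ℕ) : MeasurableEmbedding fun s : E d => -s :=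
  (MeasurableEquiv.neg (E d)).measurableEmbedding

lemma stableCF_map_neg {d : ℕ} (α : ℝ) (Γ : Measure (E d)) (m u : E d) :
    stableCF α (Γ.map fun s => -s) (-m) u = stableCF α Γ m (-u) := by
  simp only [stableCF]
  rw [(measurableEmbedding_neg d).integral_map]
  simp [inner_neg_right, inner_neg_left]

lemma IsSymmetric.charFun_neg {d : ℕ} {ν : Measure (E d)} (h : IsSymmetric ν) (u : E d) :
    charFun ν (-u) = charFun ν u := by
  conv_rhs => rw [← h]
  simp only [charFun_apply]
  rw [(measurableEmbedding_neg d).integral_map]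
  simp [inner_neg_right, inner_neg_left]

lemma unitSphere_map_neg {d : ℕ} {Γ : Measure (E d)} (hΓ : Γ (unitSphere d)ᶜ = 0) :
    (Γ.map fun s => -s) (unitSphere d)ᶜ = 0 := by
  rw [(measurableEmbedding_neg d).map_apply]
  convert hΓ using 2
  ext s; simp [unitSphere]

/-- The reflected pair gives the characteristic function at -u, which for a symmetric law is the
same; uniqueness identifies the two pairs. -/
lemma IsSpectralRep.symmetric {d : ℕ} {α : ℝ} (hα0 : 0 < α) (hα2 : α < 2)
    {ν Γ : Measure (E d)} {m : E d} (h : IsSpectralRep α ν Γ m) (hν : IsSymmetric ν) :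
    IsSymmetric Γ ∧ m = 0 := by
  have := h.finite
  obtain ⟨h1, h2⟩ := eq_of_stableCF_eq hα0 hα2 (unitSphere_map_neg h.concentrated)
    h.concentrated (m := -m) (m' := m) fun u => by
      rw [stableCF_map_neg, ← h.charFun_eq, ← h.charFun_eq, hν.charFun_neg]
  refine ⟨h1, ?_⟩
  ext j
  have hj : -m j = m j := congrArg (fun x : E d => x j) h2
  rw [PiLp.zero_apply]
  linarith

lemma stableCF_eq_symStableCF {d : ℕ} {α : ℝ} (hα : 0 < α)
    {Γ : Measure (E d)} [IsFiniteMeasure Γ] (hΓ : Γ (unitSphere d)ᶜ = 0) (hs : IsSymmetric Γ)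
    (u : E d) : stableCF α Γ 0 u = symStableCF α Γ u := by
  have h1 := integrable_comp_inner hΓ (continuous_abs_rpow hα) u
  have h2 := integrable_comp_inner hΓ (continuous_kernOdd hα) u
  have h3 : ∫ s, kernOdd α (inner ℝ u s) ∂Γ = 0 := by
    have : ∫ s, kernOdd α (inner ℝ u s) ∂Γ = -∫ s, kernOdd α (inner ℝ u s) ∂Γ := by
      conv_lhs => rw [← hs]
      rw [(measurableEmbedding_neg d).integral_map]
      simp [inner_neg_right, kernOdd_neg, integral_neg]
    linarith
  simp only [stableCF, symStableCF, kern_eq]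
  rw [integral_sub h1.ofReal (h2.ofReal.const_mul _), integral_const_mul,
        integral_complex_ofReal, integral_complex_ofReal, h3]
  simp

/-! ### Radial projection between sphere and cylinder -/

lemma continuous_seminorm {d : ℕ} (p : Seminorm ℝ (E d)) : Continuous p :=
  continuousOn_univ.1 (p.convexOn.continuousOn isOpen_univ)

lemma measurableSet_sphere_diff {d : ℕ} (p : Seminorm ℝ (E d)) :
    MeasurableSet (unitSphere d \ kernelSet p) := by
  have h1 : MeasurableSet (unitSphere d) := (isClosed_eq continuous_norm continuous_const).measurableSet
  exact h1.diff (h1.inter (isClosed_eq (continuous_seminorm p) continuous_const).measurableSet)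

lemma measurable_normalize {d : ℕ} (p : Seminorm ℝ (E d)) :
    Measurable fun s : E d => (p s)⁻¹ • s :=
  (continuous_seminorm p).measurable.inv.smul measurable_id

lemma ne_zero_of_seminorm_eq_one {d : ℕ} {p : Seminorm ℝ (E d)} {s : E d} (hs : p s = 1) :
    s ≠ 0 := by
  rintro rfl
  simp at hs

lemma ae_seminorm_eq_one {d : ℕ} {p : Seminorm ℝ (E d)} {γ : Measure (E d)}
    (h : γ (cylinder p)ᶜ = 0) : ∀ᵐ s ∂γ, p s = 1 := h

/-- The measure `‖s‖ ^ α γ(ds)`, projected radially to the Euclidean unit sphere. -/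
def sphereMeasure {d : ℕ} (α : ℝ) (γ : Measure (E d)) : Measure (E d) :=
  (γ.withDensity fun s => ENNReal.ofReal (‖s‖ ^ α)).map fun s => ‖s‖⁻¹ • s

lemma lintegral_sphereMeasure {d : ℕ} (α : ℝ) (γ : Measure (E d)) {f : E d → ENNReal}
    (hf : Measurable f) :
    ∫⁻ s, f s ∂(sphereMeasure α γ) = ∫⁻ s, ENNReal.ofReal (‖s‖ ^ α) * f (‖s‖⁻¹ • s) ∂γ := by
  rw [sphereMeasure, lintegral_map hf (by fun_prop),
    lintegral_withDensity_eq_lintegral_mul _ (by fun_prop)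
      (by fun_prop : Measurable fun s : E d => f (‖s‖⁻¹ • s))]
  rfl

lemma integral_sphereMeasure {d : ℕ} {F : Type*} [NormedAddCommGroup F] [NormedSpace ℝ F]
    (α : ℝ) (γ : Measure (E d)) {f : E d → F} (hf : StronglyMeasurable f) :
    ∫ s, f s ∂(sphereMeasure α γ) = ∫ s, (‖s‖ ^ α) • f (‖s‖⁻¹ • s) ∂γ := by
  rw [sphereMeasure, integral_map (by fun_prop) hf.aestronglyMeasurable,
    integral_withDensity_eq_integral_toReal_smul (by fun_prop)
      (ae_of_all _ fun _ => ENNReal.ofReal_lt_top)]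
  simp only [ENNReal.toReal_ofReal (Real.rpow_nonneg (norm_nonneg _) _)]

/-- On the sphere ‖s/p(s)‖ = 1/p(s), so the density ‖·‖^(-α) pulls back to p(s)^α. -/
lemma lintegral_cylinderMeasure {d : ℕ} (p : Seminorm ℝ (E d)) (α : ℝ) (Γ : Measure (E d))
    {f : E d → ENNReal} (hf : Measurable f) :
    ∫⁻ s, f s ∂(cylinderMeasure p α Γ) =
      ∫⁻ s in unitSphere d \ kernelSet p,
        ENNReal.ofReal (p s ^ α) * f ((p s)⁻¹ • s) ∂Γ := by
  rw [cylinderMeasure, lintegral_withDensity_eq_lintegral_mul _ (by fun_prop) hf,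
    lintegral_map (Measurable.mul (by fun_prop) hf) (measurable_normalize p)]
  refine setLIntegral_congr_fun (measurableSet_sphere_diff p) fun s hs => ?_
  have h1 : ‖s‖ = 1 := hs.1
  have h0 : 0 < p s := lt_of_le_of_ne (apply_nonneg p s) fun h => hs.2 ⟨hs.1, h.symm⟩
  simp only [Pi.mul_apply, norm_smul, h1, mul_one, norm_inv, Real.norm_of_nonneg h0.le]
  rw [Real.inv_rpow h0.le, Real.rpow_neg h0.le, inv_inv]

lemma cylinderMeasure_compl {d : ℕ} (p : Seminorm ℝ (E d)) (α : ℝ) (Γ : Measure (E d)) :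
    cylinderMeasure p α Γ (cylinder p)ᶜ = 0 := by
  have hm : MeasurableSet (cylinder p)ᶜ :=
    (isClosed_eq (continuous_seminorm p) continuous_const).measurableSet.compl
  rw [← lintegral_indicator_one hm, lintegral_cylinderMeasure p α Γ
    (measurable_one.indicator hm)]
  rw [setLIntegral_congr_fun (g := 0) (measurableSet_sphere_diff p) fun s hs => ?_]
  · simp
  · have h0 : 0 < p s := lt_of_le_of_ne (apply_nonneg p s) fun h => hs.2 ⟨hs.1, h.symm⟩
    have : p ((p s)⁻¹ • s) = 1 := by
      rw [map_smul_eq_mul, norm_inv, Real.norm_of_nonneg h0.le, inv_mul_cancel₀ h0.ne']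
    simp [cylinder, this]

/-- A projected point has p(s/‖s‖) = 1/‖s‖ ≠ 0. This is the necessity of Γ(K) = 0. -/
lemma sphereMeasure_kernelSet {d : ℕ} {p : Seminorm ℝ (E d)} (α : ℝ) {γ : Measure (E d)}
    (hγ : γ (cylinder p)ᶜ = 0) : sphereMeasure α γ (kernelSet p) = 0 := by
  have h1 : MeasurableSet (unitSphere d) := (isClosed_eq continuous_norm continuous_const).measurableSet
  have hm : MeasurableSet (kernelSet p) :=
    h1.inter (isClosed_eq (continuous_seminorm p) continuous_const).measurableSet
  rw [← lintegral_indicator_one hm, lintegral_sphereMeasure α γ (measurable_one.indicator hm),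
    lintegral_congr_ae (g := 0)]
  · simp
  · refine (ae_seminorm_eq_one hγ).mono fun s hs => ?_
    have h0 := norm_ne_zero_iff.2 (ne_zero_of_seminorm_eq_one hs)
    have : ‖s‖⁻¹ • s ∉ kernelSet p := fun h => by
      have h2 := h.2
      rw [map_smul_eq_mul, hs, mul_one, norm_inv, norm_norm] at h2
      exact inv_ne_zero h0 h2
    simp [this]

lemma sphereMeasure_compl {d : ℕ} {p : Seminorm ℝ (E d)} (α : ℝ) {γ : Measure (E d)}
    (hγ : γ (cylinder p)ᶜ = 0) : sphereMeasure α γ (unitSphere d)ᶜ = 0 := by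
  have hm : MeasurableSet (unitSphere d)ᶜ :=
    (isClosed_eq continuous_norm continuous_const).measurableSet.compl
  rw [← lintegral_indicator_one hm, lintegral_sphereMeasure α γ (measurable_one.indicator hm),
    lintegral_congr_ae (g := 0)]
  · simp
  · refine (ae_seminorm_eq_one hγ).mono fun s hs => ?_
    have h0 := norm_ne_zero_iff.2 (ne_zero_of_seminorm_eq_one hs)
    have : ‖s‖⁻¹ • s ∈ unitSphere d := by simp [unitSphere, norm_smul, h0]
    simp [this]

lemma cylinderMeasure_sphereMeasure {d : ℕ} {p : Seminorm ℝ (E d)} (α : ℝ) {γ : Measure (E d)}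
    (hγ : γ (cylinder p)ᶜ = 0) : cylinderMeasure p α (sphereMeasure α γ) = γ := by
  refine Measure.ext_of_lintegral _ fun f hf => ?_
  rw [lintegral_cylinderMeasure p α _ hf, ← lintegral_indicator (measurableSet_sphere_diff p),
    lintegral_sphereMeasure α γ]
  · refine lintegral_congr_ae ((ae_seminorm_eq_one hγ).mono fun s hs => ?_)
    have h0 := norm_pos_iff.2 (ne_zero_of_seminorm_eq_one hs)
    have hp : p (‖s‖⁻¹ • s) = ‖s‖⁻¹ := by
      rw [map_smul_eq_mul, hs, mul_one, norm_inv, norm_norm]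
    have hmem : ‖s‖⁻¹ • s ∈ unitSphere d \ kernelSet p := by
      refine ⟨by simp [unitSphere, norm_smul, h0.ne'], fun h => ?_⟩
      have h2 := h.2
      rw [hp] at h2
      exact inv_ne_zero h0.ne' h2
    simp only
    rw [Set.indicator_of_mem hmem, hp, ← mul_assoc,
      ← ENNReal.ofReal_mul (Real.rpow_nonneg h0.le _), Real.inv_rpow h0.le,
      mul_inv_cancel₀ (Real.rpow_pos_of_pos h0 α).ne', inv_inv, smul_smul,
      mul_inv_cancel₀ h0.ne', one_smul, ENNReal.ofReal_one, one_mul]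
  · exact (Measurable.mul (((continuous_seminorm p).measurable.pow_const α).ennreal_ofReal)
      (hf.comp (measurable_normalize p))).indicator (measurableSet_sphere_diff p)

lemma restrict_sphere_diff {d : ℕ} {p : Seminorm ℝ (E d)} {Γ : Measure (E d)}
    (hΓ : Γ (unitSphere d)ᶜ = 0) (hK : Γ (kernelSet p) = 0) :
    Γ.restrict (unitSphere d \ kernelSet p) = Γ := by
  refine Measure.restrict_eq_self_of_ae_mem ?_
  have h1 : ∀ᵐ s ∂Γ, s ∈ unitSphere d := hΓ
  have h2 : ∀ᵐ s ∂Γ, s ∉ kernelSet p := measure_eq_zero_iff_ae_notMem.1 hK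
  filter_upwards [h1, h2] with s h1 h2 using ⟨h1, h2⟩

/-- The weights p(s)^α and p(s)^(-α) cancel. The hypothesis on K is needed because `cylinderMeasure`
discards the mass there. -/
lemma sphereMeasure_cylinderMeasure {d : ℕ} {p : Seminorm ℝ (E d)} (α : ℝ) {Γ : Measure (E d)}
    (hΓ : Γ (unitSphere d)ᶜ = 0) (hK : Γ (kernelSet p) = 0) :
    sphereMeasure α (cylinderMeasure p α Γ) = Γ := by
  refine Measure.ext_of_lintegral _ fun f hf => ?_
  rw [lintegral_sphereMeasure α _ hf, lintegral_cylinderMeasure p α Γ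
    (by fun_prop)]
  conv_rhs => rw [← restrict_sphere_diff hΓ hK]
  refine setLIntegral_congr_fun (measurableSet_sphere_diff p) fun s hs => ?_
  have h1 : ‖s‖ = 1 := hs.1
  have h0 : 0 < p s := lt_of_le_of_ne (apply_nonneg p s) fun h => hs.2 ⟨hs.1, h.symm⟩
  have hn : ‖(p s)⁻¹ • s‖ = (p s)⁻¹ := by
    rw [norm_smul, h1, mul_one, norm_inv, Real.norm_of_nonneg h0.le]
  rw [hn, ← mul_assoc, ← ENNReal.ofReal_mul (Real.rpow_nonneg h0.le _), Real.inv_rpow h0.le,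
    mul_inv_cancel₀ (Real.rpow_pos_of_pos h0 α).ne', inv_inv, smul_smul,
    mul_inv_cancel₀ h0.ne', one_smul, ENNReal.ofReal_one, one_mul]

lemma IsSymmetric.sphereMeasure {d : ℕ} (α : ℝ) {γ : Measure (E d)} (h : IsSymmetric γ) :
    IsSymmetric (sphereMeasure α γ) := by
  refine Measure.ext_of_lintegral _ fun f hf => ?_
  have hf' : Measurable fun s => f (-s) := hf.comp measurable_neg
  rw [lintegral_map hf measurable_neg, lintegral_sphereMeasure α γ hf',
    lintegral_sphereMeasure α γ hf]
  conv_rhs => rw [← h]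
  rw [lintegral_map (by fun_prop) measurable_neg]
  simp

lemma IsSymmetric.cylinderMeasure {d : ℕ} (p : Seminorm ℝ (E d)) (α : ℝ) {Γ : Measure (E d)}
    (h : IsSymmetric Γ) : IsSymmetric (cylinderMeasure p α Γ) := by
  refine Measure.ext_of_lintegral _ fun f hf => ?_
  have hf' : Measurable fun s => f (-s) := hf.comp measurable_neg
  rw [lintegral_map hf measurable_neg, lintegral_cylinderMeasure p α Γ hf',
    lintegral_cylinderMeasure p α Γ hf]
  conv_rhs => rw [← h]
  have hp := (continuous_seminorm p).measurable
  rw [setLIntegral_map (measurableSet_sphere_diff p) (by fun_prop) measurable_neg]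
  have : (fun s : E d => -s) ⁻¹' (unitSphere d \ kernelSet p) = unitSphere d \ kernelSet p := by
    ext s; simp [unitSphere, kernelSet]
  rw [this]
  simp

/-! ### Effect of the projection on the characteristic function -/

lemma symStableCF_sphereMeasure {d : ℕ} {p : Seminorm ℝ (E d)} {α : ℝ} (hα : 0 < α)
    {γ : Measure (E d)} (hγ : γ (cylinder p)ᶜ = 0) (u : E d) :
    symStableCF α (sphereMeasure α γ) u = symStableCF α γ u := by
  simp only [symStableCF]
  have hc : Continuous fun s : E d => |(inner ℝ u s : ℝ)| ^ α :=
    (continuous_abs_rpow hα).comp (by fun_prop)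
  rw [integral_sphereMeasure α γ hc.stronglyMeasurable]
  congr 3
  refine integral_congr_ae ((ae_seminorm_eq_one hγ).mono fun s hs => ?_)
  have h0 := norm_pos_iff.2 (ne_zero_of_seminorm_eq_one hs)
  simp only [smul_eq_mul]
  rw [real_inner_smul_right, abs_mul, Real.mul_rpow (abs_nonneg _) (abs_nonneg _),
    abs_of_pos (inv_pos.2 h0), ← mul_assoc, Real.inv_rpow h0.le,
    mul_inv_cancel₀ (Real.rpow_pos_of_pos h0 α).ne', one_mul]

lemma rpow_mul_kern_inv {α : ℝ} (h1 : α ≠ 1) {t : ℝ} (ht : 0 < t) (x : ℝ) :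
    ((t ^ α : ℝ) : ℂ) * kern α (t⁻¹ * x) = kern α x := by
  have hs : Real.sign (t⁻¹ * x) = Real.sign x := by
    rcases lt_trichotomy x 0 with h | h | h
    · rw [Real.sign_of_neg h, Real.sign_of_neg (mul_neg_of_pos_of_neg (inv_pos.2 ht) h)]
    · simp [h]
    · rw [Real.sign_of_pos h, Real.sign_of_pos (mul_pos (inv_pos.2 ht) h)]
  have hr : t ^ α * |t⁻¹ * x| ^ α = |x| ^ α := by
    rw [abs_mul, Real.mul_rpow (abs_nonneg _) (abs_nonneg _), abs_of_pos (inv_pos.2 ht),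
      ← mul_assoc, Real.inv_rpow ht.le, mul_inv_cancel₀ (Real.rpow_pos_of_pos ht α).ne', one_mul]
  simp only [kern, w, if_neg h1, hs]
  rw [← mul_assoc, ← Complex.ofReal_mul, hr]

/-- Homogeneity fails only through ln|x/t| = ln|x| - ln t, whose second term leaves something linear
in x. -/
lemma mul_kern_one_inv {t : ℝ} (ht : 0 < t) (x : ℝ) :
    (t : ℂ) * kern 1 (t⁻¹ * x) =
      kern 1 x - Complex.I * ((2 / Real.pi * (x * Real.log t) : ℝ) : ℂ) := by
  rw [kern_eq, kern_eq, kernOdd_one, kernOdd_one]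
  have h1 : t * |t⁻¹ * x| = |x| := by
    rw [abs_mul, abs_of_pos (inv_pos.2 ht), ← mul_assoc, mul_inv_cancel₀ ht.ne', one_mul]
  have h2 : t * (t⁻¹ * x * Real.log (t⁻¹ * x)) = x * Real.log x - x * Real.log t := by
    rcases eq_or_ne x 0 with rfl | hx
    · simp
    · rw [Real.log_mul (inv_ne_zero ht.ne') hx, Real.log_inv]; field_simp; ring
  rw [Real.rpow_one, Real.rpow_one, ← h1]
  have h3 := congrArg (fun z : ℝ => (z : ℂ)) h2
  push_cast at h3 ⊢
  linear_combination (Complex.I * (2 / Real.pi)) * h3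

lemma stableCF_sphereMeasure_of_ne_one {d : ℕ} {p : Seminorm ℝ (E d)} {α : ℝ} (hα : 0 < α)
    (h1 : α ≠ 1) {γ : Measure (E d)} (hγ : γ (cylinder p)ᶜ = 0) (m u : E d) :
    stableCF α (sphereMeasure α γ) m u = stableCF α γ m u := by
  simp only [stableCF]
  have hc : Continuous fun s : E d => kern α (inner ℝ u s) :=
    (continuous_kern hα).comp (by fun_prop)
  rw [integral_sphereMeasure α γ hc.stronglyMeasurable]
  congr 3
  refine integral_congr_ae ((ae_seminorm_eq_one hγ).mono fun s hs => ?_)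
  have h0 := norm_pos_iff.2 (ne_zero_of_seminorm_eq_one hs)
  simp only [Complex.real_smul]
  rw [real_inner_smul_right, rpow_mul_kern_inv h1 h0]

/-- For `α = 1` the radial projection changes the shift. -/
lemma stableCF_sphereMeasure_one {d : ℕ} {p : Seminorm ℝ (E d)}
    {γ : Measure (E d)} (hγ : γ (cylinder p)ᶜ = 0)
    (hint : ∀ u : E d, Integrable (fun s => kern 1 (inner ℝ u s)) γ)
    (hlog : Integrable (fun s : E d => Real.log ‖s‖ • s) γ) (m u : E d) :
    stableCF 1 (sphereMeasure 1 γ) (m - (2 / Real.pi) • ∫ s, Real.log ‖s‖ • s ∂γ) u =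
      stableCF 1 γ m u := by
  simp only [stableCF]
  have hlu : Integrable (fun s : E d => (inner ℝ u (Real.log ‖s‖ • s) : ℝ)) γ :=
    hlog.const_inner u
  have hc : Continuous fun s : E d => kern 1 (inner ℝ u s) :=
    (continuous_kern one_pos).comp (by fun_prop)
  rw [integral_sphereMeasure 1 γ hc.stronglyMeasurable]
  have : ∫ s, (‖s‖ ^ (1 : ℝ)) • kern 1 (inner ℝ u (‖s‖⁻¹ • s)) ∂γ =
      ∫ s, (kern 1 (inner ℝ u s) -
        Complex.I * ((2 / Real.pi * inner ℝ u (Real.log ‖s‖ • s) : ℝ) : ℂ)) ∂γ := by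
    refine integral_congr_ae ((ae_seminorm_eq_one hγ).mono fun s hs => ?_)
    have h0 := norm_pos_iff.2 (ne_zero_of_seminorm_eq_one hs)
    simp only [Complex.real_smul, Real.rpow_one]
    rw [real_inner_smul_right, mul_kern_one_inv h0, real_inner_smul_right, mul_comm (Real.log _)]
  have hl : Integrable (fun s : E d => Complex.I *
      ((2 / Real.pi * inner ℝ u (Real.log ‖s‖ • s) : ℝ) : ℂ)) γ :=
    (hlu.const_mul (2 / Real.pi)).ofReal.const_mul Complex.I
  rw [this, integral_sub (hint u) hl, integral_const_mul,
    integral_complex_ofReal, integral_const_mul, integral_inner hlog, inner_sub_right,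
    real_inner_smul_right]
  congr 1
  push_cast
  ring

/-! ### Integrability conditions on sphere and cylinder -/

/-- The Euclidean norm is at most the sum of the d absolute coordinates. Hence integrability tested
on the basis vectors controls the norm. -/
lemma exists_norm_le_mul_abs_coord {d : ℕ} {s : E d} (hs : s ≠ 0) :
    ∃ j : Fin d, ‖s‖ ≤ d * |s j| := by
  have hne : Nonempty (Fin d) := by
    by_contra h
    rw [not_nonempty_iff] at h
    exact hs (Subsingleton.elim _ _)
  have hd : (0 : ℝ) < d := by
    have := Fin.pos_iff_nonempty.2 hne
    exact_mod_cast this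
  have h1 : ‖s‖ ≤ ∑ j, |s j| := by
    conv_lhs => rw [← (EuclideanSpace.basisFun (Fin d) ℝ).sum_repr s]
    refine (norm_sum_le _ _).trans_eq (Finset.sum_congr rfl fun j _ => ?_)
    simp [norm_smul]
  obtain ⟨j, -, hj⟩ := Finset.exists_le_of_sum_le (s := Finset.univ) (f := fun _ : Fin d => ‖s‖ / d)
    (g := fun j => |s j|) Finset.univ_nonempty (by
      simp only [Finset.sum_const, Finset.card_univ, Fintype.card_fin, nsmul_eq_mul]
      rwa [mul_div_cancel₀ _ hd.ne'])
  exact ⟨j, by rw [div_le_iff₀ hd] at hj; linarith⟩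

lemma lintegral_lt_top_of_exists_le {d : ℕ} {γ : Measure (E d)} {F : E d → ENNReal}
    {G : Fin d → E d → ENNReal} (hG : ∀ j, Measurable (G j))
    (h : ∀ᵐ s ∂γ, ∃ j, F s ≤ G j s) (hfin : ∀ j, ∫⁻ s, G j s ∂γ < ⊤) : ∫⁻ s, F s ∂γ < ⊤ := by
  refine lt_of_le_of_lt (lintegral_mono_ae (g := fun s => ∑ j, G j s) (h.mono fun s hs => ?_)) ?_
  · obtain ⟨j, hj⟩ := hs
    exact hj.trans (Finset.single_le_sum (f := fun j => G j s) (fun _ _ => zero_le)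
      (Finset.mem_univ j))
  · rw [lintegral_finsetSum _ fun j _ => hG j]
    exact ENNReal.sum_lt_top.2 fun j _ => hfin j

lemma inner_single_one {d : ℕ} (j : Fin d) (s : E d) :
    (inner ℝ (EuclideanSpace.single j (1 : ℝ)) s : ℝ) = s j := by
  simp [EuclideanSpace.inner_single_left]

lemma IntegSimple.isFiniteMeasure_sphereMeasure {d : ℕ} {p : Seminorm ℝ (E d)} {α : ℝ}
    (hα : 0 < α) {γ : Measure (E d)} (hγ : γ (cylinder p)ᶜ = 0) (h : IntegSimple α γ) :
    IsFiniteMeasure (sphereMeasure α γ) := by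
  refine ⟨?_⟩
  rw [← lintegral_one, lintegral_sphereMeasure α γ measurable_const]
  simp only [mul_one]
  refine lintegral_lt_top_of_exists_le
    (G := fun j s => ENNReal.ofReal ((d : ℝ) ^ α) * ENNReal.ofReal (|s j| ^ α))
    (fun j => by fun_prop) ((ae_seminorm_eq_one hγ).mono fun s hs => ?_) fun j => ?_
  · obtain ⟨j, hj⟩ := exists_norm_le_mul_abs_coord (ne_zero_of_seminorm_eq_one hs)
    refine ⟨j, ?_⟩
    rw [← ENNReal.ofReal_mul (by positivity), ← Real.mul_rpow (by positivity) (abs_nonneg _)]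
    exact ENNReal.ofReal_le_ofReal (Real.rpow_le_rpow (norm_nonneg _) hj hα.le)
  · rw [lintegral_const_mul _ (by fun_prop)]
    have := h (EuclideanSpace.single j 1)
    simp only [inner_single_one] at this
    exact ENNReal.mul_lt_top ENNReal.ofReal_lt_top this

lemma measurable_abs_mul_abs_log_inner {d : ℕ} (u : E d) : Measurable fun s : E d =>
    ENNReal.ofReal (|(inner ℝ u s : ℝ)| * |Real.log (|(inner ℝ u s : ℝ)|)|) :=
  ((continuous_abs.measurable.mul
    (continuous_abs.measurable.comp (Real.measurable_log.comp continuous_abs.measurable))).comp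
    (by fun_prop : Measurable fun s : E d => (inner ℝ u s : ℝ))).ennreal_ofReal

/-- ln|x| and ln|2x| differ by ln 2 > 1/2, so they cannot both be small. -/
lemma abs_le_two_mul_abs_log (x : ℝ) :
    |x| ≤ 2 * (|x| * |Real.log (|x|)| + |2 * x| * |Real.log (|2 * x|)|) := by
  rcases eq_or_ne x 0 with rfl | hx
  · simp
  have hx' : 0 < |x| := abs_pos.2 hx
  have h2 : Real.log (|2 * x|) = Real.log 2 + Real.log (|x|) := by
    rw [abs_mul, abs_two, Real.log_mul two_ne_zero hx'.ne']
  have h3 : 1 / 2 ≤ |Real.log (|x|)| + |Real.log (|2 * x|)| := by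
    have := Real.log_two_gt_d9
    rw [h2]
    have h4 := le_abs_self (Real.log 2 + Real.log (|x|))
    have h5 := neg_le_abs (Real.log (|x|))
    linarith
  have h4 : |2 * x| = 2 * |x| := by rw [abs_mul, abs_two]
  have h5 := mul_le_mul_of_nonneg_left h3 hx'.le
  have h6 : 0 ≤ |x| * |Real.log (|2 * x|)| := by positivity
  have h7 : |2 * x| * |Real.log (|2 * x|)| = 2 * (|x| * |Real.log (|2 * x|)|) := by rw [h4]; ring
  rw [h7]
  linarith

lemma IntegLog.integSimple {d : ℕ} {γ : Measure (E d)} (h : IntegLog γ) : IntegSimple 1 γ := by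
  intro u
  -- The condition at u alone is blind to points with |⟨u,s⟩| = 1, where the logarithm vanishes; the
  -- condition at 2u covers them.
  have h2 := h ((2 : ℝ) • u)
  refine lt_of_le_of_lt (lintegral_mono (g := fun s => 2 *
    (ENNReal.ofReal (|(inner ℝ u s : ℝ)| * |Real.log (|(inner ℝ u s : ℝ)|)|) +
      ENNReal.ofReal (|(inner ℝ ((2 : ℝ) • u) s : ℝ)| *
        |Real.log (|(inner ℝ ((2 : ℝ) • u) s : ℝ)|)|))) fun s => ?_) ?_
  · have := ENNReal.ofReal_le_ofReal (abs_le_two_mul_abs_log (inner ℝ u s))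
    rw [ENNReal.ofReal_mul zero_le_two, ENNReal.ofReal_add (by positivity) (by positivity),
      ENNReal.ofReal_ofNat] at this
    simpa only [Real.rpow_one, real_inner_smul_left] using this
  · have hm := (measurable_abs_mul_abs_log_inner u).add
      (measurable_abs_mul_abs_log_inner ((2 : ℝ) • u))
    simp only [Pi.add_def] at hm
    rw [lintegral_const_mul _ hm, lintegral_add_left (measurable_abs_mul_abs_log_inner u)]
    exact ENNReal.mul_lt_top ENNReal.ofNat_lt_top (ENNReal.add_lt_top.2 ⟨h u, h2⟩)

lemma IntegLog.lintegral_norm_mul_log_lt_top {d : ℕ} {p : Seminorm ℝ (E d)}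
    {γ : Measure (E d)} (hγ : γ (cylinder p)ᶜ = 0) (h : IntegLog γ) :
    ∫⁻ s, ENNReal.ofReal (‖s‖ * |Real.log ‖s‖|) ∂γ < ⊤ := by
  have hm : ∀ j : Fin d, Measurable fun s : E d =>
      ENNReal.ofReal (|s j| * |Real.log (|s j|)|) := fun j => by
    simpa only [inner_single_one] using
      measurable_abs_mul_abs_log_inner (EuclideanSpace.single j (1 : ℝ))
  have hm' : ∀ j : Fin d, Measurable fun s : E d => ENNReal.ofReal (|s j| ^ (1 : ℝ)) :=
    fun j => by fun_prop
  refine lintegral_lt_top_of_exists_le (G := fun j s => ENNReal.ofReal d *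
    (ENNReal.ofReal (|s j| * |Real.log (|s j|)|) +
      ENNReal.ofReal (Real.log d) * ENNReal.ofReal (|s j| ^ (1 : ℝ))))
    (fun j => ((hm j).add ((hm' j).const_mul _)).const_mul _)
    ((ae_seminorm_eq_one hγ).mono fun s hs => ?_) fun j => ?_
  · have hs0 := ne_zero_of_seminorm_eq_one hs
    have h0 := norm_pos_iff.2 hs0
    obtain ⟨j, hj⟩ := exists_norm_le_mul_abs_coord hs0
    refine ⟨j, ?_⟩
    have hd : 1 ≤ d := Nat.one_le_iff_ne_zero.2 (Fin.pos_iff_nonempty.2 ⟨j⟩).ne'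
    have hd' : (1 : ℝ) ≤ d := by exact_mod_cast hd
    have hlogd : 0 ≤ Real.log d := Real.log_nonneg hd'
    have hsj : 0 < |s j| := by
      by_contra hc
      have : |s j| = 0 := le_antisymm (not_lt.1 hc) (abs_nonneg _)
      rw [this, mul_zero] at hj
      linarith
    have hle : |s j| ≤ ‖s‖ := PiLp.norm_apply_le s j
    have hl1 : Real.log (|s j|) ≤ Real.log ‖s‖ := Real.log_le_log hsj hle
    have hl2 : Real.log ‖s‖ ≤ Real.log d + Real.log (|s j|) := by
      rw [← Real.log_mul (by positivity) hsj.ne']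
      exact Real.log_le_log h0 hj
    -- Since |s_j| ≤ ‖s‖ ≤ d|s_j|, the two logarithms differ by at most ln d.
    have hl3 : |Real.log ‖s‖| ≤ |Real.log (|s j|)| + Real.log d := by
      refine abs_le.2 ⟨?_, ?_⟩
      · linarith [neg_abs_le (Real.log (|s j|))]
      · linarith [le_abs_self (Real.log (|s j|))]
    rw [Real.rpow_one, ← ENNReal.ofReal_mul hlogd, ← ENNReal.ofReal_add (by positivity)
      (by positivity), ← ENNReal.ofReal_mul (by positivity)]
    refine ENNReal.ofReal_le_ofReal ?_
    calc ‖s‖ * |Real.log ‖s‖| ≤ (d * |s j|) * (|Real.log (|s j|)| + Real.log d) := by gcongr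
      _ = _ := by ring
  · have h1 := h (EuclideanSpace.single j 1)
    have h2 := h.integSimple (EuclideanSpace.single j 1)
    simp only [inner_single_one] at h1 h2
    have hm2 := (hm' j).const_mul (ENNReal.ofReal (Real.log d))
    have hm3 := (hm j).add hm2
    simp only [Pi.add_def] at hm3
    rw [lintegral_const_mul _ hm3, lintegral_add_left (hm j), lintegral_const_mul _ (hm' j)]
    exact ENNReal.mul_lt_top ENNReal.ofReal_lt_top
      (ENNReal.add_lt_top.2 ⟨h1, ENNReal.mul_lt_top ENNReal.ofReal_lt_top h2⟩)

lemma IntegLog.integrable_log_smul {d : ℕ} {p : Seminorm ℝ (E d)}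
    {γ : Measure (E d)} (hγ : γ (cylinder p)ᶜ = 0) (h : IntegLog γ) :
    Integrable (fun s : E d => Real.log ‖s‖ • s) γ := by
  refine ⟨Measurable.aestronglyMeasurable
    ((Real.measurable_log.comp measurable_norm).smul measurable_id), ?_⟩
  rw [hasFiniteIntegral_iff_norm]
  simpa only [norm_smul, Real.norm_eq_abs, mul_comm] using h.lintegral_norm_mul_log_lt_top hγ

lemma IntegLog.integrable_kern {d : ℕ} {γ : Measure (E d)} (h : IntegLog γ) (u : E d) :
    Integrable (fun s => kern 1 (inner ℝ u s)) γ := by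
  have hu : Measurable fun s : E d => (inner ℝ u s : ℝ) := by fun_prop
  have h1 : Integrable (fun s : E d => |(inner ℝ u s : ℝ)| ^ (1 : ℝ)) γ := by
    refine ⟨Measurable.aestronglyMeasurable (by fun_prop), ?_⟩
    rw [hasFiniteIntegral_iff_norm]
    simpa using h.integSimple u
  have h2 : Integrable (fun s : E d => (inner ℝ u s : ℝ) * Real.log (inner ℝ u s)) γ := by
    refine ⟨Measurable.aestronglyMeasurable (hu.mul (Real.measurable_log.comp hu)), ?_⟩
    rw [hasFiniteIntegral_iff_norm]
    simpa using h u
  simp only [kern_eq, kernOdd_one]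
  exact h1.ofReal.sub ((h2.const_mul _).ofReal.const_mul _)

/-- The factor p(s)^α cancels by homogeneity, so the integral is bounded by the one over the sphere
whatever p is. -/
lemma integSimple_cylinderMeasure {d : ℕ} (p : Seminorm ℝ (E d)) {α : ℝ} (hα : 0 < α)
    {Γ : Measure (E d)} [IsFiniteMeasure Γ] (hΓ : Γ (unitSphere d)ᶜ = 0) :
    IntegSimple α (cylinderMeasure p α Γ) := by
  intro u
  rw [lintegral_cylinderMeasure p α Γ (by fun_prop)]
  have h := (integrable_comp_inner hΓ (continuous_abs_rpow hα) u).2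
  rw [hasFiniteIntegral_iff_ofReal (ae_of_all _ fun s => Real.rpow_nonneg (abs_nonneg _) _)] at h
  refine lt_of_le_of_lt ?_ h
  refine le_trans (setLIntegral_congr_fun (measurableSet_sphere_diff p) fun s hs => ?_).le
    (setLIntegral_le_lintegral (unitSphere d \ kernelSet p) _)
  have h0 : 0 < p s := lt_of_le_of_ne (apply_nonneg p s) fun h => hs.2 ⟨hs.1, h.symm⟩
  rw [← ENNReal.ofReal_mul (Real.rpow_nonneg h0.le _), real_inner_smul_right, abs_mul,
    Real.mul_rpow (abs_nonneg _) (abs_nonneg _), abs_of_pos (inv_pos.2 h0), ← mul_assoc,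
    Real.inv_rpow h0.le, mul_inv_cancel₀ (Real.rpow_pos_of_pos h0 α).ne', one_mul]

lemma measurable_absLog : Measurable absLog :=
  Measurable.ite (measurableSet_singleton 0) measurable_const
    (continuous_abs.measurable.comp Real.measurable_log).ennreal_ofReal

/-- With x = ⟨u,s⟩, rescaling turns |x||ln|x|| into at most |x||ln|x|| + ‖u‖|ln p(s)|. The first
term is bounded on the sphere, and the second is the hypothesis. -/
lemma integLog_cylinderMeasure (d : ℕ) (p : Seminorm ℝ (E d))
    {Γ : Measure (E d)} [IsFiniteMeasure Γ] (hΓ : Γ (unitSphere d)ᶜ = 0)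
    (hlog : ∫⁻ s in unitSphere d, absLog (p s) ∂Γ < ⊤) :
    IntegLog (cylinderMeasure p 1 Γ) := by
  intro u
  have hp := (continuous_seminorm p).measurable
  rw [lintegral_cylinderMeasure p 1 Γ (measurable_abs_mul_abs_log_inner u)]
  have h := (integrable_comp_inner hΓ Real.continuous_mul_log.abs u).2
  rw [hasFiniteIntegral_iff_ofReal (ae_of_all _ fun s => abs_nonneg _)] at h
  have hb : ∀ s ∈ unitSphere d \ kernelSet p, ENNReal.ofReal (p s ^ (1 : ℝ)) *
      ENNReal.ofReal (|(inner ℝ u ((p s)⁻¹ • s) : ℝ)| *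
        |Real.log (|(inner ℝ u ((p s)⁻¹ • s) : ℝ)|)|) ≤
      ENNReal.ofReal (|(inner ℝ u s : ℝ) * Real.log (inner ℝ u s)|) +
        ENNReal.ofReal ‖u‖ * absLog (p s) := by
    intro s hs
    have h1 : ‖s‖ = 1 := hs.1
    have h0 : 0 < p s := lt_of_le_of_ne (apply_nonneg p s) fun h => hs.2 ⟨hs.1, h.symm⟩
    have hi := abs_real_inner_le_norm u s
    rw [h1, mul_one] at hi
    rw [absLog, if_neg h0.ne', ← ENNReal.ofReal_mul (norm_nonneg _),
      ← ENNReal.ofReal_add (abs_nonneg _) (by positivity),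
      ← ENNReal.ofReal_mul (Real.rpow_nonneg h0.le _), real_inner_smul_right, Real.rpow_one]
    refine ENNReal.ofReal_le_ofReal ?_
    generalize (inner ℝ u s : ℝ) = x at hi
    rcases eq_or_ne x 0 with rfl | hx
    · simp only [mul_zero, abs_zero, zero_mul, zero_add]; positivity
    · rw [Real.log_abs, Real.log_mul (inv_ne_zero h0.ne') hx, Real.log_inv, abs_mul, abs_mul,
        abs_of_pos (inv_pos.2 h0), mul_assoc, mul_inv_cancel_left₀ h0.ne']
      have h2 : |-Real.log (p s) + Real.log x| ≤ |Real.log x| + |Real.log (p s)| := by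
        have := abs_add_le (-Real.log (p s)) (Real.log x)
        rw [abs_neg] at this; linarith
      calc |x| * |-Real.log (p s) + Real.log x| ≤ |x| * (|Real.log x| + |Real.log (p s)|) := by
            gcongr
        _ = |x| * |Real.log x| + |x| * |Real.log (p s)| := by ring
        _ ≤ |x| * |Real.log x| + ‖u‖ * |Real.log (p s)| := by gcongr
  have hm : Measurable fun s : E d => absLog (p s) := measurable_absLog.comp hp
  refine lt_of_le_of_lt (setLIntegral_mono_ae' (measurableSet_sphere_diff p)
    (ae_of_all _ hb)) ?_
  rw [lintegral_add_right _ (hm.const_mul _), lintegral_const_mul _ hm]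
  refine ENNReal.add_lt_top.2 ⟨(setLIntegral_le_lintegral _ _).trans_lt h,
    ENNReal.mul_lt_top ENNReal.ofReal_lt_top ?_⟩
  exact (lintegral_mono_set Set.sdiff_subset).trans_lt hlog

lemma kernelSet_eq_zero_of_lintegral_absLog {d : ℕ} {p : Seminorm ℝ (E d)} {Γ : Measure (E d)}
    (hlog : ∫⁻ s in unitSphere d, absLog (p s) ∂Γ < ⊤) : Γ (kernelSet p) = 0 := by
  have hm : MeasurableSet (unitSphere d) :=
    (isClosed_eq continuous_norm continuous_const).measurableSet
  have h := ae_lt_top (measurable_absLog.comp (continuous_seminorm p).measurable) hlog.ne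
  rw [ae_restrict_iff' hm] at h
  refine measure_mono_null (fun s hs => ?_) (ae_iff.1 h)
  simp [hs.1, hs.2, absLog]

/-- Since p(s/‖s‖) = 1/‖s‖, the integral becomes that of ‖s‖|ln‖s‖| against γ. -/
lemma lintegral_absLog_sphereMeasure {d : ℕ} {p : Seminorm ℝ (E d)}
    {γ : Measure (E d)} (hγ : γ (cylinder p)ᶜ = 0) (h : IntegLog γ) :
    ∫⁻ s in unitSphere d, absLog (p s) ∂(sphereMeasure 1 γ) < ⊤ := by
  refine (setLIntegral_le_lintegral _ _).trans_lt ?_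
  have hm : Measurable fun s : E d => absLog (p s) :=
    measurable_absLog.comp (continuous_seminorm p).measurable
  rw [lintegral_sphereMeasure 1 γ hm]
  refine lt_of_eq_of_lt (lintegral_congr_ae ((ae_seminorm_eq_one hγ).mono fun s hs => ?_))
    (h.lintegral_norm_mul_log_lt_top hγ)
  have h0 := norm_pos_iff.2 (ne_zero_of_seminorm_eq_one hs)
  simp only [map_smul_eq_mul, hs, mul_one, norm_inv, norm_norm, absLog, inv_eq_zero, h0.ne',
    if_false, Real.rpow_one, Real.log_inv, abs_neg]
  rw [ENNReal.ofReal_mul h0.le]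

/-! ### The shift, and representations on the cylinder -/

/-- The sign changes because ln p(s/‖s‖) = -ln‖s‖; the weight ‖s‖ cancels the normalization of the
coordinate. -/
lemma shiftCorrection_sphereMeasure {d : ℕ} {p : Seminorm ℝ (E d)}
    {γ : Measure (E d)} (hγ : γ (cylinder p)ᶜ = 0) (h : IntegLog γ) :
    shiftCorrection p (sphereMeasure 1 γ) = (2 / Real.pi) • ∫ s, Real.log ‖s‖ • s ∂γ := by
  ext j
  have hp := (continuous_seminorm p).measurable
  have hm : StronglyMeasurable fun s : E d => s j * Real.log (p s) :=
    Measurable.stronglyMeasurable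
      ((by fun_prop : Measurable fun s : E d => s j).mul (Real.measurable_log.comp hp))
  have hj : (∫ s, Real.log ‖s‖ • s ∂γ) j = ∫ s, Real.log ‖s‖ * s j ∂γ := by
    have := (EuclideanSpace.proj j : E d →L[ℝ] ℝ).integral_comp_comm
      (h.integrable_log_smul hγ)
    simpa using this.symm
  simp only [shiftCorrection, PiLp.smul_apply, smul_eq_mul, hj]
  rw [restrict_sphere_diff (sphereMeasure_compl 1 hγ) (sphereMeasure_kernelSet 1 hγ),
    integral_sphereMeasure 1 γ hm]
  have : ∫ s : E d, (‖s‖ ^ (1 : ℝ)) • ((‖s‖⁻¹ • s) j * Real.log (p (‖s‖⁻¹ • s))) ∂γ =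
      ∫ s : E d, -(Real.log ‖s‖ * s j) ∂γ := by
    refine integral_congr_ae ((ae_seminorm_eq_one hγ).mono fun s hs => ?_)
    have h0 := norm_pos_iff.2 (ne_zero_of_seminorm_eq_one hs)
    simp only [map_smul_eq_mul, hs, mul_one, norm_inv, norm_norm, Real.rpow_one, Real.log_inv,
      smul_eq_mul, PiLp.smul_apply]
    field_simp
  rw [this, integral_neg]
  ring

/-- A representation on the cylinder projects to the spectral representation on the sphere. -/
lemma IsCylinderRep.unique {d : ℕ} {p : Seminorm ℝ (E d)} {α : ℝ} (hα0 : 0 < α) (hα2 : α < 2)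
    {ν Γ γ : Measure (E d)} {μ₀ m : E d} (hΓ : IsSpectralRep α ν Γ μ₀)
    (h : IsCylinderRep p α ν γ m) :
    sphereMeasure α γ = Γ ∧ m = cylinderShift p α ν Γ μ₀ := by
  have := hΓ.finite
  have hγ := h.concentrated
  have hc := sphereMeasure_compl α hγ
  by_cases hν : IsSymmetric ν
  · obtain ⟨rfl, hs, hi, hcf⟩ := h.symmetric hν
    have := hi.isFiniteMeasure_sphereMeasure hα0 hγ
    rw [cylinderShift, if_neg fun h => h.2 hν]
    refine eq_of_stableCF_eq hα0 hα2 hc hΓ.concentrated fun u => ?_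
    rw [stableCF_eq_symStableCF hα0 hc (hs.sphereMeasure α), symStableCF_sphereMeasure hα0 hγ,
      ← hcf, hΓ.charFun_eq]
  · obtain ⟨hi, hl, hcf⟩ := h.asymmetric hν
    by_cases h1 : α = 1
    · subst h1
      have hl := hl rfl
      have := hl.integSimple.isFiniteMeasure_sphereMeasure hα0 hγ
      obtain ⟨hΓΓ, hm⟩ := eq_of_stableCF_eq hα0 hα2 hc hΓ.concentrated fun u => by
        rw [stableCF_sphereMeasure_one hγ hl.integrable_kern (hl.integrable_log_smul hγ) m u,
          ← hcf, hΓ.charFun_eq]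
      refine ⟨hΓΓ, ?_⟩
      rw [cylinderShift, if_pos ⟨rfl, hν⟩, ← hΓΓ, shiftCorrection_sphereMeasure hγ hl, ← hm,
        sub_add_cancel]
    · have := (hi h1).isFiniteMeasure_sphereMeasure hα0 hγ
      rw [cylinderShift, if_neg fun h => h1 h.1]
      refine eq_of_stableCF_eq hα0 hα2 hc hΓ.concentrated fun u => ?_
      rw [stableCF_sphereMeasure_of_ne_one hα0 h1 hγ, ← hcf, hΓ.charFun_eq]

/-- Projecting back to the sphere recovers Γ because K is null, so the characteristic function can
be compared there. For a symmetric law, Γ is symmetric and μ⁰ vanishes by uniqueness. -/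
lemma isCylinderRep_cylinderMeasure {d : ℕ} {p : Seminorm ℝ (E d)} {α : ℝ} (hα0 : 0 < α)
    (hα2 : α < 2) {ν Γ : Measure (E d)} {μ₀ : E d} (hΓ : IsSpectralRep α ν Γ μ₀)
    (hK : Γ (kernelSet p) = 0)
    (hlog : α = 1 → ¬ IsSymmetric ν → ∫⁻ s in unitSphere d, absLog (p s) ∂Γ < ⊤) :
    IsCylinderRep p α ν (cylinderMeasure p α Γ) (cylinderShift p α ν Γ μ₀) := by
  have := hΓ.finite
  have hγ := cylinderMeasure_compl p α Γ
  have hback := sphereMeasure_cylinderMeasure α hΓ.concentrated hK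
  have hsimple := integSimple_cylinderMeasure p hα0 hΓ.concentrated
  refine ⟨hγ, fun hν => ⟨fun _ => hsimple, fun h1 => ?_, fun u => ?_⟩, fun hν => ?_⟩
  · subst h1
    exact integLog_cylinderMeasure d p hΓ.concentrated (hlog rfl hν)
  · by_cases h1 : α = 1
    · subst h1
      have hl := integLog_cylinderMeasure d p hΓ.concentrated (hlog rfl hν)
      rw [← stableCF_sphereMeasure_one hγ hl.integrable_kern (hl.integrable_log_smul hγ),
        ← shiftCorrection_sphereMeasure hγ hl, hback, cylinderShift, if_pos ⟨rfl, hν⟩,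
        add_sub_cancel_right, hΓ.charFun_eq]
    · rw [cylinderShift, if_neg fun h => h1 h.1, ← stableCF_sphereMeasure_of_ne_one hα0 h1 hγ,
        hback, hΓ.charFun_eq]
  · obtain ⟨hs, rfl⟩ := hΓ.symmetric hα0 hα2 hν
    rw [cylinderShift, if_neg fun h => h.2 hν]
    refine ⟨rfl, hs.cylinderMeasure p α, hsimple, fun u => ?_⟩
    rw [← symStableCF_sphereMeasure hα0 hγ, hback, ← stableCF_eq_symStableCF hα0
      hΓ.concentrated hs, hΓ.charFun_eq]

end

end StableCylinder

theorem proposition1 {d : ℕ} {Ω : Type*} [MeasurableSpace Ω] (P : MeasureTheory.Measure Ω)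
    [MeasureTheory.IsProbabilityMeasure P] (X : Ω → EuclideanSpace ℝ (Fin d))
    (hX : AEMeasurable X P) (α : ℝ) (hα0 : 0 < α) (hα2 : α < 2)
    (hstable : StableCylinder.IsAlphaStable α (P.map X))
    (Γ : MeasureTheory.Measure (EuclideanSpace ℝ (Fin d))) (μ₀ : EuclideanSpace ℝ (Fin d))
    (hΓ : StableCylinder.IsSpectralRep α (P.map X) Γ μ₀)
    (p : Seminorm ℝ (EuclideanSpace ℝ (Fin d))) :
    ((α ≠ 1 ∨ StableCylinder.IsSymmetric (P.map X)) →
      (StableCylinder.IsRepresentable p α (P.map X) ↔ Γ (StableCylinder.kernelSet p) = 0)) ∧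
    (α = 1 → ¬ StableCylinder.IsSymmetric (P.map X) →
      (StableCylinder.IsRepresentable p α (P.map X) ↔
        ∫⁻ s in StableCylinder.unitSphere d, StableCylinder.absLog (p s) ∂Γ < ⊤)) ∧
    (StableCylinder.IsRepresentable p α (P.map X) →
      ∀ (γ : MeasureTheory.Measure (EuclideanSpace ℝ (Fin d))) (m : EuclideanSpace ℝ (Fin d)),
        StableCylinder.IsCylinderRep p α (P.map X) γ m ↔
          γ = StableCylinder.cylinderMeasure p α Γ ∧
            m = StableCylinder.cylinderShift p α (P.map X) Γ μ₀) := by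
  open StableCylinder in
  have := hΓ.finite
  refine ⟨fun hcase => ⟨?_, fun hK => ?_⟩, fun h1 hν => ⟨?_, fun hlog => ?_⟩, ?_⟩
  · rintro ⟨γ, m, h⟩
    rw [← (h.unique hα0 hα2 hΓ).1]
    exact sphereMeasure_kernelSet α h.concentrated
  · exact ⟨_, _, isCylinderRep_cylinderMeasure hα0 hα2 hΓ hK fun h1 hν =>
      absurd hcase (by simp [h1, hν])⟩
  · rintro ⟨γ, m, h⟩
    subst h1
    rw [← (h.unique hα0 hα2 hΓ).1]
    exact lintegral_absLog_sphereMeasure h.concentrated ((h.asymmetric hν).2.1 rfl)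
  · exact ⟨_, _, isCylinderRep_cylinderMeasure hα0 hα2 hΓ
      (kernelSet_eq_zero_of_lintegral_absLog hlog) fun _ _ => hlog⟩
  · rintro ⟨γ₀, m₀, h₀⟩ γ m
    have hγ : ∀ γ m, IsCylinderRep p α (P.map X) γ m → γ = cylinderMeasure p α Γ ∧
        m = cylinderShift p α (P.map X) Γ μ₀ := fun γ m h => by
      obtain ⟨h1, h2⟩ := h.unique hα0 hα2 hΓ
      exact ⟨by rw [← h1, cylinderMeasure_sphereMeasure α h.concentrated], h2⟩
    refine ⟨hγ γ m, ?_⟩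
    -- The representation assumed to exist must, by uniqueness, be the canonical pair, which is
    -- therefore itself a representation.
    rintro ⟨rfl, rfl⟩
    obtain ⟨h1, h2⟩ := hγ γ₀ m₀ h₀
    rwa [← h1, ← h2]
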